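/- **Setting.** Let $\Theta$ be a measurable space and, for each $n\ge1$, let $\{p^{(n)}_\theta:\theta\in\Theta\}$ be a family of probability densities with respect to a $\sigma$-finite measure $\mu^{(n)}$, jointly measurable in (observation, $\theta$); $\mathbb P^{(n)}_\theta$ is the corresponding law of the observation $X^{(n)}$. Let $\Lambda$ be countable and $\Theta=\bigcup_{\lambda\in\Lambda}\Theta_\lambda$. Let $(\pi_\lambda)_{\lambda\in\Lambda}$ be a probability distribution on $\Lambda$ and $\Pi_\lambda$ a probability measure on $\Theta$ concentrated on $\Theta_\lambda$ (both may depend on $n$). Let $\theta^*\in\Theta$ and let $\lambda^*$ index the smallest model containing it: $\Theta_{\lambda^*}=\bigcap_{\lambda:\theta^*\in\Theta_\lambda}\Theta_\lambda$. Write $\lambda>\lambda^*$ if $\lambda\ne\lambda^*$ and $\theta^*\in\Theta_\lambda$, and $\lambda<\lambda^*$ if $\Theta_{\lambda^*}\not\subseteq\Theta_\lambda$. For $0<\alpha\le1$ the ($\alpha$-fractional; regular if $\alpha=1$, then written $\Pi$) posterior probability of model $\lambda$ is $$\Pi_\alpha(\lambda\mid X^{(n)})=\frac{\pi_\lambda\int_{\Theta_\lambda}(p^{(n)}_\theta(X^{(n)}))^\alpha\,\Pi_\lambda(d\theta)}{\sum_{\lambda'}\pi_{\lambda'}\int_{\Theta_{\lambda'}}(p^{(n)}_\theta(X^{(n)}))^\alpha\,\Pi_{\lambda'}(d\theta)}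 .$$ Let $D(p,q)=\int p\log(p/q)\,d\mu$, $V(p,q)=\int p\,|\log(p/q)-D(p,q)|^2d\mu$, and for $0<\alpha<1$ let $D^{(n)}_\alpha(\theta,\theta')=\frac1{\alpha-1}\log\int (p^{(n)}_\theta)^\alpha(p^{(n)}_{\theta'})^{1-\alpha}d\mu^{(n)}$ and $D^{(n)}_\alpha(\theta,T)=\inf_{\theta'\in T}D^{(n)}_\alpha(\theta,\theta')$ for $T\subseteq\Theta$. Let $d_n$ be semimetrics on $\Theta$ (symmetric, vanishing on the diagonal, with the triangle inequality), $d_n(\theta,T)=\inf_{\theta'\in T}d_n(\theta,\theta')$, and let $N(r,F,d_n)$ be the $r$-covering number of $F$. The assumptions concern numbers $\varepsilon_{n,\lambda^*}\ge0$, $\varepsilon_{n,\lambda}$ ($\lambda>\lambda^*$), $\delta_n$, and constants $a,b,c,C,D,H,K,M$; they are required for all $n\ge1$. * **(B1)** $n\varepsilon_{n,\lambda^*}^2\to\infty$; $\Pi_{\lambda^*}\big(\theta\in\Theta_{\lambda^*}:D(p^{(n)}_{\theta^*},p^{(n)}_\theta)\le n\varepsilon_{n,\lambda^*}^2,\ V(p^{(n)}_{\theta^*},p^{(n)}_\theta)\le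 n\varepsilon_{n,\lambda^*}^2\big)\ge e^{-cn\varepsilon_{n,\lambda^*}^2}$; and $\pi_{\lambda^*}\ge e^{-n\varepsilon_{n,\lambda^*}^2}$. * **(B2)** For every $\lambda>\lambda^*$: $\varepsilon_{n,\lambda}\ge\varepsilon_{n,\lambda^*}$ and, for the regular posterior, $\Pi_\lambda(d_n(\theta,\theta^*)\le M\varepsilon_{n,\lambda})\le e^{-Hn\varepsilon_{n,\lambda^*}^2}$; for the fractional posterior, $\Pi_\lambda(n^{-1}D^{(n)}_\alpha(\theta,\theta^*)\le M\varepsilon_{n,\lambda}^2)\le e^{-Hn\varepsilon_{n,\lambda^*}^2}$. * **(B3)** $\delta_n>M\varepsilon_{n,\lambda^*}$ and, for every $\lambda<\lambda^*$: $d_n(\theta^*,\Theta_\lambda)\ge\delta_n$ for the regular posterior; $n^{-1}D^{(n)}_\alpha(\theta^*,\Theta_\lambda)\ge\delta_n^2$ for the fractional posterior. * **(B4)** For every $\lambda\neq\lambda^*$ put $r_{n,\lambda}=\delta_n/K$ if $\lambda<\lambda^*$ and $r_{n,\lambda}=\varepsilon_{n,\lambda}$ if $\lambda>\lambda^*$.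 (Tests) For all $n\ge 1$, $r>0$ and $\theta_1\in\Theta_\lambda$ with $d_n(\theta_1,\theta^*)>r$ there is a test $\phi$, with values in $[0,1]$, such that $\mathbb P^{(n)}_{\theta^*}\phi\le e^{-bnr^2}$ and $\mathbb P^{(n)}_\theta(1-\phi)\le e^{-bnr^2}$ for all $\theta\in\Theta_\lambda$ with $d_n(\theta,\theta_1)\le ar$. (Sieves) There are sets $\mathcal F_{n,\lambda}\subseteq\Theta_\lambda$ with $\log N(r_{n,\lambda},\mathcal F_{n,\lambda},d_n)\le n r_{n,\lambda}^2$ and $\Pi_\lambda(\mathcal F_{n,\lambda}^c)\le e^{-Dnr_{n,\lambda}^2}$. (Summability) $\sum_{\lambda<\lambda^*}e^{-Cn\delta_n^2}+\sum_{\lambda>\lambda^*}e^{-Cn\varepsilon_{n,\lambda}^2}\le1$. **Theorem (Model selection consistency).** 1. (Regular posteriors.) For all $a,b,c>0$ there are $K_0,D_0$ such that for all $K\ge K_0$, $D\ge D_0$ and $C>0$ there are $M_0,H_0$ such that for all $M\ge M_0$ and $H\ge H_0$: in every setting as above, B1--B4 with these constants imply $\mathbb E^{(n)}_{\theta^*}[\Pi(\lambda=\lambda^*\mid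 X^{(n)})]\to1$ as $n\to\infty$. 2. (Fractional posteriors.) For all $\alpha\in(0,1)$ and $c>0$ there are $M_0,H_0$ such that for all $M\ge M_0$ and $H\ge H_0$: in every setting as above, B1--B3 (fractional versions) with these constants imply $\mathbb E^{(n)}_{\theta^*}[\Pi_\alpha(\lambda=\lambda^*\mid X^{(n)})]\to1$ as $n\to\infty$. -/

import Mathlib

open MeasureTheory Filter Topology
open scoped ENNReal NNReal

universe u v w

namespace ModelSelection

/-! ### Statistical experiments and models -/

/-- A sequence of statistical experiments with parameter space `Θ`: for each sample size `n`, a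
sample space, a `σ`-finite dominating measure and a jointly measurable family of probability
densities. -/
structure Experiments (Θ : Type u) [MeasurableSpace Θ] where
  /-- the space in which the observation of sample size `n` takes its values -/
  Obs : ℕ → Type w
  [measurableObs : ∀ n, MeasurableSpace (Obs n)]
  /-- the dominating measure -/
  dom : ∀ n, Measure (Obs n)
  [sigmaFinite_dom : ∀ n, SigmaFinite (dom n)]
  /-- the density of the observation at sample size `n` under the parameter `θ` -/
  dens : ∀ n, Θ → Obs n → ℝ≥0
  measurable_dens : ∀ n, Measurable fun z : Obs n × Θ => dens n z.2 z.1
  lintegral_dens : ∀ n θ, ∫⁻ x, (dens n θ x : ℝ≥0∞) ∂(dom n) = 1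

attribute [instance] Experiments.measurableObs Experiments.sigmaFinite_dom

/-- The law of the observation of sample size `n` under the parameter `θ`. -/
noncomputable def Experiments.law {Θ : Type u} [MeasurableSpace Θ] (E : Experiments.{u, w} Θ)
    (n : ℕ) (θ : Θ) : Measure (E.Obs n) :=
  (E.dom n).withDensity fun x => (E.dens n θ x : ℝ≥0∞)

/-- A family of models `model l ⊆ Θ`, indexed by `l : Λ`, whose union is the whole parameter space,
with prior model weights and a prior distribution on each model. Both priors may depend on the
sample size. -/
structure Models (Θ : Type u) [MeasurableSpace Θ] (Λ : Type v) where
  model : Λ → Set Θ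
  iUnion_model : ⋃ l, model l = Set.univ
  /-- the prior weights of the models, a probability distribution on `Λ` -/
  weight : ℕ → PMF Λ
  /-- the prior distribution of the parameter within each model -/
  prior : ℕ → Λ → Measure Θ
  [isProb_prior : ∀ n l, IsProbabilityMeasure (prior n l)]
  ae_mem_model : ∀ n l, ∀ᵐ θ ∂(prior n l), θ ∈ model l

attribute [instance] Models.isProb_prior

section

variable {Θ : Type u} [MeasurableSpace Θ] {Λ : Type v}

/-- `l₀` indexes the smallest model that contains `θ₀`. -/
def Models.IsSmallest (S : Models Θ Λ) (θ₀ : Θ) (l₀ : Λ) : Prop :=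
  S.model l₀ = ⋂ l ∈ {l | θ₀ ∈ S.model l}, S.model l

/-- The indices `l > l₀`: the other models that contain the truth `θ₀`. -/
def Models.larger (S : Models Θ Λ) (θ₀ : Θ) (l₀ : Λ) : Set Λ :=
  {l | l ≠ l₀ ∧ θ₀ ∈ S.model l}

/-- The indices `l < l₀`: the models that do not contain the model `l₀`. -/
def Models.smaller (S : Models Θ Λ) (l₀ : Λ) : Set Λ :=
  {l | ¬ S.model l₀ ⊆ S.model l}

/-- The joint posterior probability of `{θ ∈ B} ∩ {model l}` given the observation `x`, with the
likelihood raised to the power `α`: the regular posterior for `α = 1`, the `α`-fractional posterior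
for `0 < α < 1`. -/
noncomputable def jointPosterior (E : Experiments.{u, w} Θ) (S : Models Θ Λ) (α : ℝ) (n : ℕ)
    (x : E.Obs n) (B : Set Θ) (l : Λ) : ℝ≥0∞ :=
  (S.weight n l * ∫⁻ θ in B, (E.dens n θ x : ℝ≥0∞) ^ α ∂(S.prior n l)) /
    ∑' l', S.weight n l' * ∫⁻ θ in S.model l', (E.dens n θ x : ℝ≥0∞) ^ α ∂(S.prior n l')

/-- The marginal posterior probability of the model `l`. -/
noncomputable def modelPosterior (E : Experiments.{u, w} Θ) (S : Models Θ Λ) (α : ℝ) (n : ℕ)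
    (x : E.Obs n) (l : Λ) : ℝ≥0∞ :=
  jointPosterior E S α n x Set.univ l

/-- The expectation under `θ₀` of the posterior probability of the model `l₀` tends to one. -/
def Consistent (E : Experiments.{u, w} Θ) (S : Models Θ Λ) (θ₀ : Θ) (l₀ : Λ) (α : ℝ) : Prop :=
  Tendsto (fun n => ∫⁻ x, modelPosterior E S α n x l₀ ∂(E.law n θ₀)) atTop (𝓝 1)

/-! ### Divergences and neighbourhoods -/

/-- The Kullback-Leibler divergence `D(p_θ₀, p_θ)` of the laws at sample size `n`. -/
noncomputable def klDist (E : Experiments.{u, w} Θ) (n : ℕ) (θ₀ θ : Θ) : ℝ≥0∞ :=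
  InformationTheory.klDiv (E.law n θ₀) (E.law n θ)

/-- The discrepancy `V(f, g) = ∫ f |log (f / g) - D(f, g)|² dμ` for `f = p_θ₀`, `g = p_θ`. It is only
meaningful (and only used) together with `D(f, g) < ∞`; then `g > 0` almost everywhere on
`{f > 0}`. -/
noncomputable def klVar (E : Experiments.{u, w} Θ) (n : ℕ) (θ₀ θ : Θ) : ℝ≥0∞ :=
  ∫⁻ x, (E.dens n θ₀ x : ℝ≥0∞) *
    ENNReal.ofReal
      ((Real.log ((E.dens n θ₀ x : ℝ) / E.dens n θ x) - (klDist E n θ₀ θ).toReal) ^ 2) ∂(E.dom n)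

/-- The Kullback-Leibler neighbourhood of radius `r` of `θ₀` inside `T ⊆ Θ`. -/
def klNhd (E : Experiments.{u, w} Θ) (T : Set Θ) (n : ℕ) (θ₀ : Θ) (r : ℝ) : Set Θ :=
  {θ | θ ∈ T ∧ klDist E n θ₀ θ ≤ ENNReal.ofReal (n * r ^ 2) ∧
    klVar E n θ₀ θ ≤ ENNReal.ofReal (n * r ^ 2)}

/-- The Rényi divergence `D_α(p_θ, p_θ') = (α - 1)⁻¹ log ∫ p_θ ^ α p_θ' ^ (1 - α) dμ` of order
`α ∈ (0, 1)` at sample size `n`, with value `⊤` if the integral vanishes. -/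
noncomputable def renyi (E : Experiments.{u, w} Θ) (α : ℝ) (n : ℕ) (θ θ' : Θ) : EReal :=
  ((1 / (α - 1) : ℝ) : EReal) *
    ENNReal.log (∫⁻ x, (E.dens n θ x : ℝ≥0∞) ^ α * (E.dens n θ' x : ℝ≥0∞) ^ (1 - α) ∂(E.dom n))

/-- `D_α(θ, T)`: the infimum of the Rényi divergence between `θ` and the points of `T`. -/
noncomputable def renyiSet (E : Experiments.{u, w} Θ) (α : ℝ) (n : ℕ) (θ : Θ) (T : Set Θ) : EReal :=
  ⨅ θ' ∈ T, renyi E α n θ θ'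

/-! ### Conditions on a single model `T` with prior sequence `Q`

A sequence of semimetrics on `Θ` is a term `d : ℕ → PseudoMetricSpace Θ`. -/

/-- Test condition with constants `a`, `b`. A test is a measurable function with values in
`[0, 1]`. -/
def TestCondition (E : Experiments.{u, w} Θ) (d : ℕ → PseudoMetricSpace Θ) (θ₀ : Θ) (T : Set Θ)
    (a b : ℝ) : Prop :=
  ∀ n : ℕ, 1 ≤ n → ∀ r : ℝ, 0 < r → ∀ θ₁ ∈ T, r < (d n).dist θ₁ θ₀ →
    ∃ φ : E.Obs n → ℝ≥0∞, Measurable φ ∧ (∀ x, φ x ≤ 1) ∧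
      ∫⁻ x, φ x ∂(E.law n θ₀) ≤ ENNReal.ofReal (Real.exp (-(b * n * r ^ 2))) ∧
      ∀ θ ∈ T, (d n).dist θ θ₁ ≤ a * r →
        ∫⁻ x, (1 - φ x) ∂(E.law n θ) ≤ ENNReal.ofReal (Real.exp (-(b * n * r ^ 2)))

/-- Prior concentration with constant `c` and rate `r n`. -/
def PriorConcentration (E : Experiments.{u, w} Θ) (θ₀ : Θ) (T : Set Θ) (Q : ℕ → Measure Θ)
    (c : ℝ) (r : ℕ → ℝ) : Prop :=
  Tendsto (fun n : ℕ => n * r n ^ 2) atTop atTop ∧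
  ∀ n : ℕ, 1 ≤ n → ENNReal.ofReal (Real.exp (-(c * n * r n ^ 2))) ≤ Q n (klNhd E T n θ₀ (r n))

/-- The covering number of `F` by closed `r`-balls (with arbitrary centres) for a semimetric. -/
noncomputable def covering (m : PseudoMetricSpace Θ) (r : ℝ) (F : Set Θ) : ℝ≥0∞ :=
  (@Metric.externalCoveringNumber Θ m.toPseudoEMetricSpace r.toNNReal F : ℕ∞)

/-- Sieve condition with constant `D` and rate `r n`. -/
def SieveCondition (d : ℕ → PseudoMetricSpace Θ) (T : Set Θ) (Q : ℕ → Measure Θ)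
    (D : ℝ) (r : ℕ → ℝ) : Prop :=
  ∃ F : ℕ → Set Θ, ∀ n : ℕ, 1 ≤ n → F n ⊆ T ∧
    ENNReal.log (covering (d n) (r n) (F n)) ≤ ((n * r n ^ 2 : ℝ) : EReal) ∧
    Q n (F n)ᶜ ≤ ENNReal.ofReal (Real.exp (-(D * n * r n ^ 2)))

/-! ### The assumptions for model selection

`ε n l` is the rate attached to the model `l` (used for `l₀` and for the larger models), `δ n` the
identifiability gap. -/

/-- Prior concentration for model selection. -/
def AssumptionB1 (E : Experiments.{u, w} Θ) (S : Models Θ Λ) (θ₀ : Θ) (l₀ : Λ) (c : ℝ)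
    (ε : ℕ → Λ → ℝ) : Prop :=
  (∀ n : ℕ, 1 ≤ n → 0 ≤ ε n l₀) ∧
  PriorConcentration E θ₀ (S.model l₀) (fun n => S.prior n l₀) c (fun n => ε n l₀) ∧
  ∀ n : ℕ, 1 ≤ n → ENNReal.ofReal (Real.exp (-(n * ε n l₀ ^ 2))) ≤ S.weight n l₀

/-- Prior anti-concentration of the larger models, for the regular posterior. -/
def AssumptionB2Regular (S : Models Θ Λ) (d : ℕ → PseudoMetricSpace Θ) (θ₀ : Θ) (l₀ : Λ)
    (M H : ℝ) (ε : ℕ → Λ → ℝ) : Prop :=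
  ∀ l ∈ S.larger θ₀ l₀, ∀ n : ℕ, 1 ≤ n → ε n l₀ ≤ ε n l ∧
    S.prior n l {θ | (d n).dist θ θ₀ ≤ M * ε n l} ≤
      ENNReal.ofReal (Real.exp (-(H * n * ε n l₀ ^ 2)))

/-- Prior anti-concentration of the larger models, for the `α`-fractional posterior. -/
def AssumptionB2Fractional (E : Experiments.{u, w} Θ) (S : Models Θ Λ) (α : ℝ) (θ₀ : Θ) (l₀ : Λ)
    (M H : ℝ) (ε : ℕ → Λ → ℝ) : Prop :=
  ∀ l ∈ S.larger θ₀ l₀, ∀ n : ℕ, 1 ≤ n → ε n l₀ ≤ ε n l ∧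
    S.prior n l {θ | (((n : ℝ)⁻¹ : ℝ) : EReal) * renyi E α n θ θ₀ ≤ ((M * ε n l ^ 2 : ℝ) : EReal)} ≤
      ENNReal.ofReal (Real.exp (-(H * n * ε n l₀ ^ 2)))

/-- Model identifiability, for the regular posterior. -/
def AssumptionB3Regular (S : Models Θ Λ) (d : ℕ → PseudoMetricSpace Θ) (θ₀ : Θ) (l₀ : Λ)
    (M : ℝ) (ε : ℕ → Λ → ℝ) (δ : ℕ → ℝ) : Prop :=
  ∀ n : ℕ, 1 ≤ n → M * ε n l₀ < δ n ∧
    ∀ l ∈ S.smaller l₀, δ n ≤ @Metric.infDist Θ (d n) θ₀ (S.model l)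

/-- Model identifiability, for the `α`-fractional posterior. -/
def AssumptionB3Fractional (E : Experiments.{u, w} Θ) (S : Models Θ Λ) (α : ℝ) (θ₀ : Θ) (l₀ : Λ)
    (M : ℝ) (ε : ℕ → Λ → ℝ) (δ : ℕ → ℝ) : Prop :=
  ∀ n : ℕ, 1 ≤ n → M * ε n l₀ < δ n ∧
    ∀ l ∈ S.smaller l₀,
      ((δ n ^ 2 : ℝ) : EReal) ≤ (((n : ℝ)⁻¹ : ℝ) : EReal) * renyiSet E α n θ₀ (S.model l)

/-- Control on model complexity: tests and sieves for all wrong models, at the rate `δ n / K` for the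
models that miss the truth and at the rate `ε n l` for the larger models, and summability. -/
def AssumptionB4 (E : Experiments.{u, w} Θ) (S : Models Θ Λ) (d : ℕ → PseudoMetricSpace Θ)
    (θ₀ : Θ) (l₀ : Λ) (a b K D C : ℝ) (ε : ℕ → Λ → ℝ) (δ : ℕ → ℝ) : Prop :=
  (∀ l ∈ S.smaller l₀, TestCondition E d θ₀ (S.model l) a b ∧
    SieveCondition d (S.model l) (fun n => S.prior n l) D (fun n => δ n / K)) ∧
  (∀ l ∈ S.larger θ₀ l₀, TestCondition E d θ₀ (S.model l) a b ∧
    SieveCondition d (S.model l) (fun n => S.prior n l) D (fun n => ε n l)) ∧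
  ∀ n : ℕ, 1 ≤ n →
    (∑' _l : S.smaller l₀, ENNReal.ofReal (Real.exp (-(C * n * δ n ^ 2)))) +
      (∑' l : S.larger θ₀ l₀, ENNReal.ofReal (Real.exp (-(C * n * ε n l ^ 2)))) ≤ 1

end

end ModelSelection

namespace ModelSelection

variable {Θ : Type u} [MeasurableSpace Θ] {Λ : Type v}

/-! ### Measurability and the laws of the observations -/

/-! Posterior model probabilities almost surely sum to one on the event used below, so it suffices
that the wrong models carry vanishing expected mass. Put R = n ε(n, l₀)², which tends to infinity.

The denominator is bounded below by the evidence of `l₀` alone. Chebyshev on the Kullback-Leibler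
neighbourhood, followed by Fubini and Markov (`law_evidence_lt_le`), shows that off an event of
probability at most 2/R the evidence integral is at least ½ exp(-(c+2)R) p₀^α, with p₀ the density
at the truth; the prior weight costs another exp(-R). Dividing by this bound replaces the random
posterior by an average affinity: the expected mass of model l, discounted by 1 - φ, is at most 2
exp((c+3)R) times its weight times the prior mean of ∫ (1 - φ) p_θ^α p₀^(1-α)
(`setLIntegral_mul_modelPosterior_le`). Hence a bound 3 exp(-(c+4)R) on that mean suffices: the
weights sum to one, and all models together contribute 6 exp(-R). The first-kind errors of the tests
φ must be summable over the models; this is the content of `consistent_of_tests`.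

For α = 1 the affinity is the second-kind error of φ. Tests glued along a cover of the sieve
(`exists_test_of_covering`) make it small, except on the sieve complement and, for larger models, on
a ball around the truth, both of small prior mass. For α < 1 no test is needed: the affinity itself
is exp(-(1-α) D_α), small by prior anti-concentration for larger models and by identifiability for
smaller ones. Identifiability has the arguments of D_α in the opposite order, which
`lintegral_affinity_swap_le` repairs. -/

theorem ofReal_exp_mul_ofReal_exp (s t : ℝ) :
    ENNReal.ofReal (Real.exp s) * ENNReal.ofReal (Real.exp t) =
      ENNReal.ofReal (Real.exp (s + t)) := by
  rw [← ENNReal.ofReal_mul (Real.exp_pos s).le, Real.exp_add]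

theorem ofReal_exp_le {s t : ℝ} (h : s ≤ t) :
    ENNReal.ofReal (Real.exp s) ≤ ENNReal.ofReal (Real.exp t) :=
  ENNReal.ofReal_le_ofReal (Real.exp_le_exp.2 h)

theorem Experiments.measurable_dens_coe (E : Experiments.{u, w} Θ) (n : ℕ) :
    Measurable fun z : E.Obs n × Θ => (E.dens n z.2 z.1 : ℝ≥0∞) :=
  (E.measurable_dens n).coe_nnreal_ennreal

theorem Experiments.measurable_dens_left (E : Experiments.{u, w} Θ) (n : ℕ) (θ : Θ) :
    Measurable (E.dens n θ) :=
  (E.measurable_dens n).comp (measurable_id.prodMk measurable_const)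

theorem Experiments.measurable_dens_left_coe (E : Experiments.{u, w} Θ) (n : ℕ) (θ : Θ) :
    Measurable fun x => (E.dens n θ x : ℝ≥0∞) :=
  (E.measurable_dens_left n θ).coe_nnreal_ennreal

theorem Experiments.lintegral_law (E : Experiments.{u, w} Θ) (n : ℕ) (θ : Θ)
    {f : E.Obs n → ℝ≥0∞} (hf : Measurable f) :
    ∫⁻ x, f x ∂(E.law n θ) = ∫⁻ x, (E.dens n θ x : ℝ≥0∞) * f x ∂(E.dom n) :=
  lintegral_withDensity_eq_lintegral_mul _ (E.measurable_dens_left_coe n θ) hf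

instance (E : Experiments.{u, w} Θ) (n : ℕ) (θ : Θ) : IsProbabilityMeasure (E.law n θ) :=
  ⟨by rw [Experiments.law, withDensity_apply _ MeasurableSet.univ, Measure.restrict_univ,
    E.lintegral_dens]⟩

theorem Experiments.law_dens_eq_zero (E : Experiments.{u, w} Θ) (n : ℕ) (θ : Θ) :
    E.law n θ {x | E.dens n θ x = 0} = 0 := by
  have hm : MeasurableSet {x | E.dens n θ x = 0} :=
    E.measurable_dens_left n θ (measurableSet_singleton 0)
  rw [Experiments.law, withDensity_apply _ hm, setLIntegral_congr_fun (g := fun _ => 0) hm]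
  · simp
  · intro x hx
    simp only [Set.mem_ofPred_eq] at hx
    simp [hx]

theorem Experiments.ae_dens_pos (E : Experiments.{u, w} Θ) (n : ℕ) (θ : Θ) :
    ∀ᵐ x ∂(E.law n θ), 0 < E.dens n θ x := by
  rw [ae_iff]
  simpa using E.law_dens_eq_zero n θ

/-! ### Lower bounds for the evidence -/

/-- Chebyshev's inequality for the log-likelihood ratio at a parameter in a Kullback-Leibler
neighbourhood of the truth. -/
theorem law_dens_lt_le_of_mem_klNhd (E : Experiments.{u, w} Θ) {T : Set Θ} {n : ℕ} {θ₀ θ : Θ}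
    {r : ℝ} (hR : 0 < n * r ^ 2) (h : θ ∈ klNhd E T n θ₀ r) :
    E.law n θ₀ {x | (E.dens n θ x : ℝ) < Real.exp (-(2 * (n * r ^ 2))) * E.dens n θ₀ x} ≤
      ENNReal.ofReal (1 / (n * r ^ 2)) := by
  obtain ⟨-, hD, hV⟩ := h
  set R : ℝ := n * r ^ 2 with hRdef
  set m : ℝ := (klDist E n θ₀ θ).toReal with hm
  have hDtop : klDist E n θ₀ θ ≠ ∞ := ne_top_of_le_ne_top ENNReal.ofReal_ne_top hD
  have hmR : m ≤ R := ENNReal.toReal_le_of_le_ofReal hR.le hD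
  -- Finite divergence forces p_θ > 0 almost surely under the truth, so the junk values of
  -- `Real.log` and of division at zero play no role.
  have hac : E.law n θ₀ ≪ E.law n θ := (InformationTheory.klDiv_ne_top_iff.1 hDtop).1
  have hpos : ∀ᵐ x ∂(E.law n θ₀), 0 < E.dens n θ x := hac.ae_le (E.ae_dens_pos n θ)
  set f : E.Obs n → ℝ≥0∞ := fun x =>
    ENNReal.ofReal ((Real.log ((E.dens n θ₀ x : ℝ) / E.dens n θ x) - m) ^ 2) with hf
  have hfm : Measurable f := by
    have h1 := (E.measurable_dens_left n θ).coe_nnreal_real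
    have h2 := (E.measurable_dens_left n θ₀).coe_nnreal_real
    exact (((Real.measurable_log.comp (h2.div h1)).sub_const m).pow_const 2).ennreal_ofReal
  have hVf : ∫⁻ x, f x ∂(E.law n θ₀) ≤ ENNReal.ofReal R := by
    rw [E.lintegral_law n θ₀ hfm]
    exact hV
  calc E.law n θ₀ {x | (E.dens n θ x : ℝ) < Real.exp (-(2 * R)) * E.dens n θ₀ x}
      ≤ E.law n θ₀ {x | ENNReal.ofReal (R ^ 2) ≤ f x} := by
        refine measure_mono_ae ?_
        filter_upwards [hpos, E.ae_dens_pos n θ₀] with x hx hx0 hlt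
        have hx' : (0 : ℝ) < E.dens n θ x := hx
        have hx0' : (0 : ℝ) < E.dens n θ₀ x := hx0
        -- The log-ratio has mean at most R; reaching 2R is a deviation of at least R, while the
        -- variance is at most R.
        have hlog : 2 * R ≤ Real.log ((E.dens n θ₀ x : ℝ) / E.dens n θ x) := by
          rw [Real.le_log_iff_exp_le (by positivity), le_div_iff₀ hx']
          have h3 : (E.dens n θ x : ℝ) < Real.exp (-(2 * R)) * E.dens n θ₀ x := hlt
          have h4 : Real.exp (2 * R) * Real.exp (-(2 * R)) = 1 := by
            rw [← Real.exp_add, add_neg_cancel, Real.exp_zero]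
          calc Real.exp (2 * R) * E.dens n θ x
              ≤ Real.exp (2 * R) * (Real.exp (-(2 * R)) * E.dens n θ₀ x) := by gcongr
            _ = E.dens n θ₀ x := by rw [← mul_assoc (Real.exp (2 * R)), h4, one_mul]
        change ENNReal.ofReal (R ^ 2) ≤ f x
        refine ENNReal.ofReal_le_ofReal ?_
        exact pow_le_pow_left₀ hR.le (by linarith) 2
    _ ≤ (∫⁻ x, f x ∂(E.law n θ₀)) / ENNReal.ofReal (R ^ 2) :=
        meas_ge_le_lintegral_div hfm.aemeasurable (by simp; positivity) ENNReal.ofReal_ne_top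
    _ ≤ ENNReal.ofReal R / ENNReal.ofReal (R ^ 2) := by gcongr
    _ = ENNReal.ofReal (1 / R) := by
        rw [← ENNReal.ofReal_div_of_pos (by positivity)]
        congr 1
        field_simp

/-- With high probability under the truth, the integrated fractional likelihood is not much smaller
than the fractional likelihood at the truth. -/
theorem law_evidence_lt_le (E : Experiments.{u, w} Θ) {T : Set Θ} {n : ℕ} {θ₀ : Θ}
    {r c α : ℝ} (hR : 0 < n * r ^ 2) (hα : 0 < α) (hα1 : α ≤ 1)
    (Q : Measure Θ) [IsProbabilityMeasure Q]
    (hQ : ENNReal.ofReal (Real.exp (-(c * n * r ^ 2))) ≤ Q (klNhd E T n θ₀ r)) :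
    E.law n θ₀ {x | ∫⁻ θ, (E.dens n θ x : ℝ≥0∞) ^ α ∂Q <
        ENNReal.ofReal (Real.exp (-((c + 2) * (n * r ^ 2)))) / 2 * (E.dens n θ₀ x : ℝ≥0∞) ^ α} ≤
      2 * ENNReal.ofReal (1 / (n * r ^ 2)) := by
  set R : ℝ := n * r ^ 2 with hRdef
  set S : Set (E.Obs n × Θ) :=
    {z | (E.dens n z.2 z.1 : ℝ) < Real.exp (-(2 * R)) * E.dens n θ₀ z.1} with hS
  have hSm : MeasurableSet S := by
    refine measurableSet_lt (E.measurable_dens n).coe_nnreal_real ?_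
    exact (((E.measurable_dens_left n θ₀).comp measurable_fst).coe_nnreal_real).const_mul _
  have hBmeas : Measurable fun θ => E.law n θ₀ ((fun x => (x, θ)) ⁻¹' S) :=
    measurable_measure_prodMk_right hSm
  -- The Kullback-Leibler neighbourhood need not be measurable. It enters only through the Chebyshev
  -- bound, so it is replaced by the measurable set of all parameters satisfying that bound.
  set B : Set Θ := {θ | E.law n θ₀ ((fun x => (x, θ)) ⁻¹' S) ≤ ENNReal.ofReal (1 / R)} with hB
  have hBm : MeasurableSet B := measurableSet_le hBmeas measurable_const
  have hsub : klNhd E T n θ₀ r ⊆ B := fun θ hθ => law_dens_lt_le_of_mem_klNhd E hR hθ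
  have hQB : ENNReal.ofReal (Real.exp (-(c * R))) ≤ Q B := by
    refine le_trans ?_ (hQ.trans (measure_mono hsub))
    rw [hRdef, mul_assoc]
  have hQB0 : Q B ≠ 0 := by
    refine (lt_of_lt_of_le ?_ hQB).ne'
    simpa using Real.exp_pos _
  have hQBtop : Q B ≠ ∞ := measure_ne_top Q B
  -- `G x` is the prior mass of the parameters of `B` whose likelihood ratio at `x` is too small. By
  -- Fubini its mean is at most Q(B)/R, so by Markov at least half of `B` is good with probability
  -- at least 1 - 2/R.
  set G : E.Obs n → ℝ≥0∞ := fun x => (Q.restrict B) (Prod.mk x ⁻¹' S) with hG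
  have hGm : Measurable G := measurable_measure_prodMk_left hSm
  have hGint : ∫⁻ x, G x ∂(E.law n θ₀) ≤ ENNReal.ofReal (1 / R) * Q B := by
    rw [← Measure.prod_apply hSm, Measure.prod_apply_symm hSm]
    calc ∫⁻ θ in B, E.law n θ₀ ((fun x => (x, θ)) ⁻¹' S) ∂Q
        ≤ ∫⁻ _ in B, ENNReal.ofReal (1 / R) ∂Q := setLIntegral_mono measurable_const fun θ h => h
      _ = ENNReal.ofReal (1 / R) * Q B := setLIntegral_const _ _
  have hhalf0 : Q B / 2 ≠ 0 := (ENNReal.div_pos hQB0 (by simp)).ne'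
  have hhalft : Q B / 2 ≠ ∞ := (ENNReal.div_lt_top hQBtop (by simp)).ne
  calc E.law n θ₀ {x | ∫⁻ θ, (E.dens n θ x : ℝ≥0∞) ^ α ∂Q <
        ENNReal.ofReal (Real.exp (-((c + 2) * R))) / 2 * (E.dens n θ₀ x : ℝ≥0∞) ^ α}
      ≤ E.law n θ₀ {x | Q B / 2 ≤ G x} := by
        refine measure_mono fun x hx => ?_
        by_contra hGx
        simp only [Set.mem_ofPred_eq, not_le] at hGx hx
        refine absurd hx (not_lt.2 ?_)
        have hSx : MeasurableSet (Prod.mk x ⁻¹' S) := hSm.preimage measurable_prodMk_left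
        have hdiff : Q B / 2 ≤ Q (B \ Prod.mk x ⁻¹' S) := by
          have h1 : Q B = G x + Q (B \ Prod.mk x ⁻¹' S) := by
            rw [hG]
            simp only
            rw [Measure.restrict_apply hSx, Set.inter_comm, measure_inter_add_sdiff _ hSx]
          by_contra hlt
          have h2 := ENNReal.add_lt_add hGx (not_le.1 hlt)
          rw [← h1, ENNReal.add_halves] at h2
          exact lt_irrefl _ h2
        have hpt : ∀ θ ∈ B \ Prod.mk x ⁻¹' S,
            ENNReal.ofReal (Real.exp (-(2 * R))) * (E.dens n θ₀ x : ℝ≥0∞) ^ α ≤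
              (E.dens n θ x : ℝ≥0∞) ^ α := by
          intro θ hθ
          have h1 : Real.exp (-(2 * R)) * E.dens n θ₀ x ≤ (E.dens n θ x : ℝ) := not_lt.1 hθ.2
          have h2 : ENNReal.ofReal (Real.exp (-(2 * R))) * (E.dens n θ₀ x : ℝ≥0∞) ≤
              (E.dens n θ x : ℝ≥0∞) := by
            rw [← ENNReal.ofReal_coe_nnreal, ← ENNReal.ofReal_coe_nnreal,
              ← ENNReal.ofReal_mul (Real.exp_pos _).le]
            exact ENNReal.ofReal_le_ofReal h1
          -- The power gives exp(-2αR), which is at least exp(-2R) since α ≤ 1; the resulting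
          -- constant is thus free of α.
          refine le_trans ?_ (ENNReal.rpow_le_rpow h2 hα.le)
          rw [ENNReal.mul_rpow_of_nonneg _ _ hα.le]
          gcongr
          conv_lhs => rw [← ENNReal.rpow_one (ENNReal.ofReal (Real.exp (-(2 * R))))]
          refine ENNReal.rpow_le_rpow_of_exponent_ge ?_ hα1
          rw [← ENNReal.ofReal_one]
          exact ENNReal.ofReal_le_ofReal (Real.exp_le_one_iff.2 (by linarith))
        calc ENNReal.ofReal (Real.exp (-((c + 2) * R))) / 2 * (E.dens n θ₀ x : ℝ≥0∞) ^ α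
            = ENNReal.ofReal (Real.exp (-(2 * R))) * (E.dens n θ₀ x : ℝ≥0∞) ^ α *
                (ENNReal.ofReal (Real.exp (-(c * R))) / 2) := by
              rw [show -((c + 2) * R) = -(2 * R) + -(c * R) by ring, ← ofReal_exp_mul_ofReal_exp]
              simp only [div_eq_mul_inv]
              ring
          _ ≤ ENNReal.ofReal (Real.exp (-(2 * R))) * (E.dens n θ₀ x : ℝ≥0∞) ^ α *
                Q (B \ Prod.mk x ⁻¹' S) := by
              gcongr
              refine le_trans ?_ hdiff
              gcongr
          _ = ∫⁻ _ in B \ Prod.mk x ⁻¹' S,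
                ENNReal.ofReal (Real.exp (-(2 * R))) * (E.dens n θ₀ x : ℝ≥0∞) ^ α ∂Q :=
              (setLIntegral_const _ _).symm
          _ ≤ ∫⁻ θ in B \ Prod.mk x ⁻¹' S, (E.dens n θ x : ℝ≥0∞) ^ α ∂Q :=
              setLIntegral_mono' (hBm.diff hSx) hpt
          _ ≤ ∫⁻ θ, (E.dens n θ x : ℝ≥0∞) ^ α ∂Q := setLIntegral_le_lintegral _ _
    _ ≤ (∫⁻ x, G x ∂(E.law n θ₀)) / (Q B / 2) :=
        meas_ge_le_lintegral_div hGm.aemeasurable hhalf0 hhalft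
    _ ≤ (ENNReal.ofReal (1 / R) * Q B) / (Q B / 2) := by gcongr
    _ = 2 * ENNReal.ofReal (1 / R) := by
        have h1 : ENNReal.ofReal (1 / R) * Q B = 2 * ENNReal.ofReal (1 / R) * (Q B / 2) := by
          rw [mul_right_comm, ENNReal.mul_div_cancel (by simp) (by simp), mul_comm]
        rw [h1, ENNReal.mul_div_cancel_right hhalf0 hhalft]

/-! ### Posterior probabilities of the models -/

/-- The numerator of the posterior probability of the model `l`. -/
noncomputable def evidence (E : Experiments.{u, w} Θ) (S : Models Θ Λ) (α : ℝ) (n : ℕ)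
    (x : E.Obs n) (l : Λ) : ℝ≥0∞ :=
  S.weight n l * ∫⁻ θ, (E.dens n θ x : ℝ≥0∞) ^ α ∂(S.prior n l)

theorem measurable_evidence (E : Experiments.{u, w} Θ) (S : Models Θ Λ) (α : ℝ) (n : ℕ) (l : Λ) :
    Measurable fun x => evidence E S α n x l :=
  (((E.measurable_dens_coe n).pow_const α).lintegral_prod_right').const_mul _

/-- Each prior is concentrated on its model, so restricting the integrals to the model changes
nothing. -/
theorem modelPosterior_eq (E : Experiments.{u, w} Θ) (S : Models Θ Λ) (α : ℝ) (n : ℕ)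
    (x : E.Obs n) (l : Λ) :
    modelPosterior E S α n x l = evidence E S α n x l / ∑' l', evidence E S α n x l' := by
  simp only [modelPosterior, jointPosterior, evidence, Measure.restrict_univ,
    Measure.restrict_eq_self_of_ae_mem (S.ae_mem_model n _)]

theorem measurable_modelPosterior [Countable Λ] (E : Experiments.{u, w} Θ) (S : Models Θ Λ) (α : ℝ)
    (n : ℕ) (l : Λ) : Measurable fun x => modelPosterior E S α n x l := by
  simp only [modelPosterior_eq]
  exact (measurable_evidence E S α n l).div
    (Measurable.tsum fun l' => measurable_evidence E S α n l')

theorem modelPosterior_le_one (E : Experiments.{u, w} Θ) (S : Models Θ Λ) (α : ℝ)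
    (n : ℕ) (x : E.Obs n) (l : Λ) : modelPosterior E S α n x l ≤ 1 := by
  rw [modelPosterior_eq]
  exact (ENNReal.div_le_div_right (ENNReal.le_tsum l) _).trans ENNReal.div_self_le_one

theorem tsum_modelPosterior (E : Experiments.{u, w} Θ) (S : Models Θ Λ) (α : ℝ)
    (n : ℕ) (x : E.Obs n) (h0 : ∑' l', evidence E S α n x l' ≠ 0)
    (ht : ∑' l', evidence E S α n x l' ≠ ∞) : ∑' l, modelPosterior E S α n x l = 1 := by
  simp only [modelPosterior_eq, div_eq_mul_inv]
  rw [ENNReal.tsum_mul_right, ENNReal.mul_inv_cancel h0 ht]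

/-- The total evidence is almost everywhere finite. -/
theorem ae_tsum_evidence_ne_top [Countable Λ] (E : Experiments.{u, w} Θ) (S : Models Θ Λ) {α : ℝ}
    (hα : 0 < α) (hα1 : α ≤ 1) (n : ℕ) :
    ∀ᵐ x ∂(E.dom n), ∑' l, evidence E S α n x l ≠ ∞ := by
  -- From t^α ≤ 1 + t: the fractional case reduces to α = 1, where the total evidence is a
  -- probability density.
  have hle : ∀ x, ∑' l, evidence E S α n x l ≤ 1 + ∑' l, evidence E S 1 n x l := by
    intro x
    rw [← (S.weight n).tsum_coe, ← ENNReal.tsum_add]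
    refine ENNReal.tsum_le_tsum fun l => ?_
    calc evidence E S α n x l
        ≤ S.weight n l * ∫⁻ θ, (1 + (E.dens n θ x : ℝ≥0∞) ^ (1 : ℝ)) ∂(S.prior n l) := by
          refine mul_le_mul_right (lintegral_mono fun θ => ?_) _
          rcases le_total (E.dens n θ x : ℝ≥0∞) 1 with h | h
          · exact (ENNReal.rpow_le_one h hα.le).trans le_self_add
          · exact (ENNReal.rpow_le_rpow_of_exponent_le h hα1).trans le_add_self
      _ = S.weight n l + evidence E S 1 n x l := by
          rw [lintegral_add_left measurable_const, lintegral_const, measure_univ, one_mul, mul_add,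
            mul_one, evidence]
  have hint : ∫⁻ x, ∑' l, evidence E S 1 n x l ∂(E.dom n) = 1 := by
    rw [lintegral_tsum fun l => (measurable_evidence E S 1 n l).aemeasurable,
      ← (S.weight n).tsum_coe]
    refine tsum_congr fun l => ?_
    simp only [evidence, ENNReal.rpow_one]
    rw [lintegral_const_mul _ ((E.measurable_dens_coe n).lintegral_prod_right'),
      lintegral_lintegral_swap (E.measurable_dens_coe n).aemeasurable]
    simp [E.lintegral_dens]
  have hfin := ae_lt_top' (Measurable.tsum fun l =>
    measurable_evidence E S 1 n l).aemeasurable (by rw [hint]; simp)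
  filter_upwards [hfin] with x hx
  exact ne_top_of_le_ne_top (ENNReal.add_ne_top.2 ⟨by simp, hx.ne⟩) (hle x)

theorem law_absolutelyContinuous (E : Experiments.{u, w} Θ) (n : ℕ) (θ : Θ) :
    E.law n θ ≪ E.dom n :=
  withDensity_absolutelyContinuous _ _

/-- The event that the evidence of the model `l₀` is at least `κ` times the likelihood at the
truth. -/
def evidenceEvent (E : Experiments.{u, w} Θ) (S : Models Θ Λ) (α : ℝ) (n : ℕ) (θ₀ : Θ) (l₀ : Λ)
    (κ : ℝ≥0∞) : Set (E.Obs n) :=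
  {x | κ * (E.dens n θ₀ x : ℝ≥0∞) ^ α ≤ ∫⁻ θ, (E.dens n θ x : ℝ≥0∞) ^ α ∂(S.prior n l₀)}

theorem measurableSet_evidenceEvent (E : Experiments.{u, w} Θ) (S : Models Θ Λ) (α : ℝ) (n : ℕ)
    (θ₀ : Θ) (l₀ : Λ) (κ : ℝ≥0∞) : MeasurableSet (evidenceEvent E S α n θ₀ l₀ κ) :=
  measurableSet_le (((E.measurable_dens_left_coe n θ₀).pow_const α).const_mul _)
    (((E.measurable_dens_coe n).pow_const α).lintegral_prod_right')

/-- On the evidence event, the expected posterior probability of a model, discounted by a weight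
`ψ`, is controlled by the affinities of order `α` between the parameters of the model and the
truth. -/
theorem setLIntegral_mul_modelPosterior_le (E : Experiments.{u, w} Θ) (S : Models Θ Λ) {α : ℝ}
    (n : ℕ) (θ₀ : Θ) (l₀ l : Λ) (κ : ℝ≥0∞)
    {ψ : E.Obs n → ℝ≥0∞} (hψ : Measurable ψ)
    (hmeas : Measurable fun x => modelPosterior E S α n x l) :
    ∫⁻ x in evidenceEvent E S α n θ₀ l₀ κ, ψ x * modelPosterior E S α n x l ∂(E.law n θ₀) ≤
      S.weight n l * (S.weight n l₀ * κ)⁻¹ *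
        ∫⁻ θ, ∫⁻ x, ψ x * ((E.dens n θ x : ℝ≥0∞) ^ α * (E.dens n θ₀ x : ℝ≥0∞) ^ (1 - α))
          ∂(E.dom n) ∂(S.prior n l) := by
  set A := evidenceEvent E S α n θ₀ l₀ κ with hA
  have hAm : MeasurableSet A := measurableSet_evidenceEvent E S α n θ₀ l₀ κ
  have hI : Measurable fun x => ∫⁻ θ, (E.dens n θ x : ℝ≥0∞) ^ α ∂(S.prior n l) :=
    ((E.measurable_dens_coe n).pow_const α).lintegral_prod_right'
  have hpt : ∀ x, (E.dens n θ₀ x : ℝ≥0∞) * A.indicator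
        (fun x => ψ x * modelPosterior E S α n x l) x ≤
      S.weight n l * (S.weight n l₀ * κ)⁻¹ * (ψ x * ((E.dens n θ₀ x : ℝ≥0∞) ^ (1 - α) *
        ∫⁻ θ, (E.dens n θ x : ℝ≥0∞) ^ α ∂(S.prior n l))) := by
    intro x
    -- The cancellation p · p^(-α) = p^(1-α) needs p ≠ 0; where p = 0 the left side vanishes.
    rcases eq_or_ne (E.dens n θ₀ x) 0 with h0 | h0
    · simp [h0]
    by_cases hx : x ∈ A
    swap
    · simp [hx]
    rw [Set.indicator_of_mem hx, modelPosterior_eq]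
    set p : ℝ≥0∞ := (E.dens n θ₀ x : ℝ≥0∞) with hp
    have hp0 : p ≠ 0 := by simpa [hp] using h0
    have hpt : p ≠ ∞ := ENNReal.coe_ne_top
    have hpα0 : p ^ α ≠ 0 := by simp [ENNReal.rpow_eq_zero_iff, hp0, hpt]
    have hpαt : p ^ α ≠ ∞ := by simp [ENNReal.rpow_eq_top_iff, hp0, hpt]
    have hden : S.weight n l₀ * κ * p ^ α ≤ ∑' l', evidence E S α n x l' := by
      refine le_trans ?_ (ENNReal.le_tsum l₀)
      rw [mul_assoc, evidence]
      exact mul_le_mul_right hx _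
    have hpow : p * (p ^ α)⁻¹ = p ^ (1 - α) := by
      rw [← ENNReal.rpow_neg, sub_eq_add_neg, ENNReal.rpow_add _ _ hp0 hpt, ENNReal.rpow_one]
    calc p * (ψ x * (evidence E S α n x l / ∑' l', evidence E S α n x l'))
        ≤ p * (ψ x * (evidence E S α n x l / (S.weight n l₀ * κ * p ^ α))) := by gcongr
      _ = S.weight n l * (S.weight n l₀ * κ)⁻¹ * (ψ x * ((p * (p ^ α)⁻¹) *
            ∫⁻ θ, (E.dens n θ x : ℝ≥0∞) ^ α ∂(S.prior n l))) := by
          rw [evidence, div_eq_mul_inv, ENNReal.mul_inv (Or.inr hpαt) (Or.inr hpα0)]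
          ring
      _ = _ := by rw [hpow]
  have hjm : Measurable fun z : E.Obs n × Θ =>
      ψ z.1 * ((E.dens n z.2 z.1 : ℝ≥0∞) ^ α * (E.dens n θ₀ z.1 : ℝ≥0∞) ^ (1 - α)) :=
    (hψ.comp measurable_fst).mul (((E.measurable_dens_coe n).pow_const α).mul
      (((E.measurable_dens_left_coe n θ₀).comp measurable_fst).pow_const _))
  calc ∫⁻ x in A, ψ x * modelPosterior E S α n x l ∂(E.law n θ₀)
      = ∫⁻ x, (E.dens n θ₀ x : ℝ≥0∞) * A.indicator
          (fun x => ψ x * modelPosterior E S α n x l) x ∂(E.dom n) := by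
        rw [← lintegral_indicator hAm, E.lintegral_law]
        exact (hψ.mul hmeas).indicator hAm
    _ ≤ ∫⁻ x, S.weight n l * (S.weight n l₀ * κ)⁻¹ * (ψ x * ((E.dens n θ₀ x : ℝ≥0∞) ^ (1 - α) *
          ∫⁻ θ, (E.dens n θ x : ℝ≥0∞) ^ α ∂(S.prior n l))) ∂(E.dom n) := lintegral_mono hpt
    _ = S.weight n l * (S.weight n l₀ * κ)⁻¹ * ∫⁻ x, ∫⁻ θ,
          ψ x * ((E.dens n θ x : ℝ≥0∞) ^ α * (E.dens n θ₀ x : ℝ≥0∞) ^ (1 - α))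
            ∂(S.prior n l) ∂(E.dom n) := by
        have hrm : Measurable fun x => ψ x * ((E.dens n θ₀ x : ℝ≥0∞) ^ (1 - α) *
            ∫⁻ θ, (E.dens n θ x : ℝ≥0∞) ^ α ∂(S.prior n l)) :=
          hψ.mul (((E.measurable_dens_left_coe n θ₀).pow_const _).mul hI)
        rw [lintegral_const_mul _ hrm]
        congr 1
        refine lintegral_congr fun x => ?_
        have hm : Measurable fun θ => (E.dens n θ x : ℝ≥0∞) ^ α :=
          ((E.measurable_dens_coe n).comp measurable_prodMk_left).pow_const α
        rw [lintegral_const_mul _ (hm.mul_const _), lintegral_mul_const _ hm, mul_comm (_ ^ (1 - α))]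
    _ = _ := by rw [lintegral_lintegral_swap hjm.aemeasurable]

/-- Consistency of model selection from tests: every wrong model is rejected by a test, up to a
small prior average of the affinities of order `α` with the truth. -/
theorem consistent_of_tests [Countable Λ] (E : Experiments.{u, w} Θ) (S : Models Θ Λ) {θ₀ : Θ}
    {l₀ : Λ} {c α : ℝ} {ε : ℕ → Λ → ℝ} (hα : 0 < α) (hα1 : α ≤ 1)
    (hB1 : AssumptionB1 E S θ₀ l₀ c ε) (V : ℕ → Λ → ℝ≥0∞) {B : ℝ≥0∞} (hB : B ≠ ∞)
    (hV : ∀ n : ℕ, 1 ≤ n → ∑' l, V n l ≤ B)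
    (htest : ∀ n : ℕ, 1 ≤ n → 0 < ε n l₀ → ∀ l, l ≠ l₀ →
      ∃ φ : E.Obs n → ℝ≥0∞, Measurable φ ∧ (∀ x, φ x ≤ 1) ∧
        ∫⁻ x, φ x ∂(E.law n θ₀) ≤ ENNReal.ofReal (Real.exp (-(n * ε n l₀ ^ 2))) * V n l ∧
        ∫⁻ θ, ∫⁻ x, (1 - φ x) * ((E.dens n θ x : ℝ≥0∞) ^ α * (E.dens n θ₀ x : ℝ≥0∞) ^ (1 - α))
          ∂(E.dom n) ∂(S.prior n l) ≤
            3 * ENNReal.ofReal (Real.exp (-((c + 4) * (n * ε n l₀ ^ 2))))) :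
    Consistent E S θ₀ l₀ α := by
  classical
  obtain ⟨hε, ⟨hlim, hconc⟩, hweight⟩ := hB1
  set R : ℕ → ℝ := fun n => n * ε n l₀ ^ 2 with hR
  -- The first term pays for failure of the evidence bound, `B` for the first-kind errors of the
  -- tests, and 6 = 2 · 3 for the affinities.
  set err : ℕ → ℝ≥0∞ := fun n =>
    2 * ENNReal.ofReal (1 / R n) + ENNReal.ofReal (Real.exp (-(R n))) * (B + 6) with herr
  have herr0 : Tendsto err atTop (𝓝 0) := by
    have h1 : Tendsto (fun n => ENNReal.ofReal (1 / R n)) atTop (𝓝 0) := by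
      rw [← ENNReal.ofReal_zero]
      exact ENNReal.tendsto_ofReal (by simpa [Pi.inv_def] using hlim.inv_tendsto_atTop)
    have h2 : Tendsto (fun n => ENNReal.ofReal (Real.exp (-(R n)))) atTop (𝓝 0) := by
      rw [← ENNReal.ofReal_zero]
      exact ENNReal.tendsto_ofReal (Real.tendsto_exp_neg_atTop_nhds_zero.comp hlim)
    have h3 := ENNReal.Tendsto.const_mul (a := 2) h1 (Or.inr (by simp))
    have h4 := ENNReal.Tendsto.mul_const (b := B + 6) h2
      (Or.inr (ENNReal.add_ne_top.2 ⟨hB, by simp⟩))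
    simpa [herr] using h3.add h4
  have hmain : ∀ n : ℕ, 1 ≤ n → 0 < R n →
      1 ≤ ∫⁻ x, modelPosterior E S α n x l₀ ∂(E.law n θ₀) + err n := by
    intro n hn hRn
    have hεpos : 0 < ε n l₀ := by
      refine lt_of_le_of_ne (hε n hn) fun h => ?_
      simp [hR, ← h] at hRn
    set κ : ℝ≥0∞ := ENNReal.ofReal (Real.exp (-((c + 2) * R n))) / 2 with hκ
    have hexp0 : ∀ t : ℝ, ENNReal.ofReal (Real.exp t) ≠ 0 := fun t => by
      simpa using Real.exp_pos t
    have hκ0 : κ ≠ 0 := (ENNReal.div_pos (hexp0 _) (by simp)).ne'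
    have hκt : κ ≠ ∞ := (ENNReal.div_lt_top ENNReal.ofReal_ne_top (by simp)).ne
    have hw := hweight n hn
    have hw0 : S.weight n l₀ ≠ 0 :=
      (lt_of_lt_of_le (pos_iff_ne_zero.2 (hexp0 _)) hw).ne'
    set A := evidenceEvent E S α n θ₀ l₀ κ with hA
    have hAm : MeasurableSet A := measurableSet_evidenceEvent E S α n θ₀ l₀ κ
    have hAc : E.law n θ₀ Aᶜ ≤ 2 * ENNReal.ofReal (1 / R n) := by
      refine le_trans (measure_mono fun x hx => ?_)
        (law_evidence_lt_le E hRn hα hα1 (S.prior n l₀) (hconc n hn))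
      rw [Set.mem_compl_iff, hA, evidenceEvent, Set.mem_ofPred_eq, not_le] at hx
      exact hx
    have hinv : (S.weight n l₀ * κ)⁻¹ ≤ 2 * ENNReal.ofReal (Real.exp ((c + 3) * R n)) := by
      have h1 : ENNReal.ofReal (Real.exp (-((c + 3) * R n))) / 2 ≤ S.weight n l₀ * κ := by
        rw [show -((c + 3) * R n) = -(R n) + -((c + 2) * R n) by ring, ← ofReal_exp_mul_ofReal_exp,
          mul_div_assoc]
        gcongr
      refine (ENNReal.inv_le_inv.2 h1).trans_eq ?_
      rw [ENNReal.inv_div (by simp) (by simp), div_eq_mul_inv,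
        ← ENNReal.ofReal_inv_of_pos (Real.exp_pos _), ← Real.exp_neg, neg_neg]
    have hother : ∀ l, l ≠ l₀ → ∫⁻ x in A, modelPosterior E S α n x l ∂(E.law n θ₀) ≤
        ENNReal.ofReal (Real.exp (-(R n))) * (V n l + 6 * S.weight n l) := by
      intro l hl
      obtain ⟨φ, hφm, hφ1, hφ0, hφa⟩ := htest n hn hεpos l hl
      have hpm := measurable_modelPosterior E S α n l
      calc ∫⁻ x in A, modelPosterior E S α n x l ∂(E.law n θ₀)
          ≤ ∫⁻ x in A, (φ x + (1 - φ x) * modelPosterior E S α n x l) ∂(E.law n θ₀) := by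
            -- Split by 1 = φ + (1 - φ), bounding the posterior by one where it is multiplied by φ.
            refine lintegral_mono fun x => ?_
            calc modelPosterior E S α n x l
                = (φ x + (1 - φ x)) * modelPosterior E S α n x l := by
                  rw [add_tsub_cancel_of_le (hφ1 x), one_mul]
              _ ≤ φ x + (1 - φ x) * modelPosterior E S α n x l := by
                  rw [add_mul]
                  gcongr
                  exact mul_le_of_le_one_right' (modelPosterior_le_one E S α n x l)
        _ = ∫⁻ x in A, φ x ∂(E.law n θ₀) +
              ∫⁻ x in A, (1 - φ x) * modelPosterior E S α n x l ∂(E.law n θ₀) :=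
            lintegral_add_left hφm _
        _ ≤ ENNReal.ofReal (Real.exp (-(R n))) * V n l +
              S.weight n l * (2 * ENNReal.ofReal (Real.exp ((c + 3) * R n))) *
                (3 * ENNReal.ofReal (Real.exp (-((c + 4) * R n)))) := by
            refine add_le_add ((setLIntegral_le_lintegral _ _).trans hφ0) ?_
            refine (setLIntegral_mul_modelPosterior_le E S n θ₀ l₀ l κ
              (ψ := fun x => 1 - φ x) (measurable_const.sub hφm) hpm).trans ?_
            gcongr
        _ = ENNReal.ofReal (Real.exp (-(R n))) * (V n l + 6 * S.weight n l) := by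
            rw [show -(R n) = (c + 3) * R n + -((c + 4) * R n) by ring, ← ofReal_exp_mul_ofReal_exp]
            ring
    have hAle : E.law n θ₀ A ≤ ∫⁻ x, modelPosterior E S α n x l₀ ∂(E.law n θ₀) +
        ENNReal.ofReal (Real.exp (-(R n))) * (B + 6) := by
      calc E.law n θ₀ A = ∫⁻ _ in A, 1 ∂(E.law n θ₀) := by simp
        _ ≤ ∫⁻ x in A, ∑' l, modelPosterior E S α n x l ∂(E.law n θ₀) := by
            refine setLIntegral_mono_ae' hAm ?_
            filter_upwards [E.ae_dens_pos n θ₀,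
              (law_absolutelyContinuous E n θ₀).ae_le (ae_tsum_evidence_ne_top E S hα hα1 n)]
              with x hx0 hxt hxA
            refine (tsum_modelPosterior E S α n x ?_ hxt).ge
            have h1 : S.weight n l₀ * (κ * (E.dens n θ₀ x : ℝ≥0∞) ^ α) ≠ 0 := by
              refine mul_ne_zero hw0 (mul_ne_zero hκ0 ?_)
              simp [ENNReal.rpow_eq_zero_iff, hx0.ne']
            refine (lt_of_lt_of_le (pos_iff_ne_zero.2 h1) ?_).ne'
            exact le_trans (mul_le_mul_right hxA _)
              (ENNReal.le_tsum (f := fun l' => evidence E S α n x l') l₀)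
        _ = ∑' l, ∫⁻ x in A, modelPosterior E S α n x l ∂(E.law n θ₀) :=
            lintegral_tsum fun l => (measurable_modelPosterior E S α n l).aemeasurable
        _ = ∫⁻ x in A, modelPosterior E S α n x l₀ ∂(E.law n θ₀) + ∑' l, ite (l = l₀) 0
              (∫⁻ x in A, modelPosterior E S α n x l ∂(E.law n θ₀)) :=
            ENNReal.tsum_eq_add_tsum_ite l₀
        _ ≤ ∫⁻ x, modelPosterior E S α n x l₀ ∂(E.law n θ₀) +
              ∑' l, ENNReal.ofReal (Real.exp (-(R n))) * (V n l + 6 * S.weight n l) := by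
            refine add_le_add (setLIntegral_le_lintegral _ _) (ENNReal.tsum_le_tsum fun l => ?_)
            split_ifs with h
            · exact zero_le
            · exact hother l h
        _ ≤ ∫⁻ x, modelPosterior E S α n x l₀ ∂(E.law n θ₀) +
              ENNReal.ofReal (Real.exp (-(R n))) * (B + 6) := by
            rw [ENNReal.tsum_mul_left, ENNReal.tsum_add, ENNReal.tsum_mul_left,
              (S.weight n).tsum_coe, mul_one]
            gcongr
            exact hV n hn
    calc (1 : ℝ≥0∞) = E.law n θ₀ A + E.law n θ₀ Aᶜ := by
          rw [measure_add_measure_compl hAm, measure_univ]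
      _ ≤ (∫⁻ x, modelPosterior E S α n x l₀ ∂(E.law n θ₀) +
            ENNReal.ofReal (Real.exp (-(R n))) * (B + 6)) + 2 * ENNReal.ofReal (1 / R n) := by
          gcongr
      _ = _ := by
          rw [herr]
          ring
  refine tendsto_of_tendsto_of_tendsto_of_le_of_le' (g := fun n => 1 - err n) (h := fun _ => 1)
    ?_ tendsto_const_nhds ?_ (Eventually.of_forall fun n => ?_)
  · simpa using ENNReal.Tendsto.sub (tendsto_const_nhds (x := (1 : ℝ≥0∞))) herr0
      (Or.inl (by simp))
  · filter_upwards [eventually_ge_atTop 1, hlim.eventually_gt_atTop 0] with n hn hRn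
    exact tsub_le_iff_right.2 (hmain n hn hRn)
  · refine (lintegral_mono fun x => modelPosterior_le_one E S α n x l₀).trans ?_
    simp

/-! ### Consistency of the regular posterior -/

/-- A global test obtained from local tests along a finite cover. -/
theorem exists_test_of_covering (E : Experiments.{u, w} Θ) {d : ℕ → PseudoMetricSpace Θ} {θ₀ : Θ}
    {T F : Set Θ} {a b : ℝ} (hT : TestCondition E d θ₀ T a b) {n : ℕ} (hn : 1 ≤ n)
    {ρ r s : ℝ} (hρ : 0 ≤ ρ) (hr : 0 < r) (hρr : 2 * ρ ≤ a * r) {G : Set Θ} (hGF : G ⊆ F)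
    (hGT : G ⊆ T) (hGd : ∀ θ ∈ G, r < (d n).dist θ θ₀)
    (hcov : ENNReal.log (covering (d n) ρ F) ≤ (s : EReal)) :
    ∃ φ : E.Obs n → ℝ≥0∞, Measurable φ ∧ (∀ x, φ x ≤ 1) ∧
      ∫⁻ x, φ x ∂(E.law n θ₀) ≤ ENNReal.ofReal (Real.exp (s - b * n * r ^ 2)) ∧
      ∀ θ ∈ G, ∫⁻ x, (1 - φ x) ∂(E.law n θ) ≤ ENNReal.ofReal (Real.exp (-(b * n * r ^ 2))) := by
  classical
  let := d n
  set e : ℝ≥0∞ := ENNReal.ofReal (Real.exp (-(b * n * r ^ 2))) with he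
  have hcov' : covering (d n) ρ F ≤ ENNReal.ofReal (Real.exp s) := by
    rw [← ENNReal.log_le_log_iff, ENNReal.log_ofReal_of_pos (Real.exp_pos s), Real.log_exp]
    exact hcov
  -- A real bound on the log-covering number excludes the value `⊤`, so the cover can be taken
  -- finite.
  have hne : Metric.externalCoveringNumber ρ.toNNReal F ≠ ⊤ := by
    intro h
    simp only [covering, h] at hcov'
    simp at hcov'
  obtain ⟨N, hN, hNcard⟩ : ∃ N : Set Θ, Metric.IsCover ρ.toNNReal F N ∧
      N.encard = Metric.externalCoveringNumber ρ.toNNReal F := by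
    have h1 : Nonempty {N : Set Θ // Metric.IsCover ρ.toNNReal F N} := ⟨⟨F, Metric.IsCover.rfl⟩⟩
    obtain ⟨N, hN⟩ := ciInf_mem fun N : {N : Set Θ // Metric.IsCover ρ.toNNReal F N} =>
      (N : Set Θ).encard
    refine ⟨N, N.2, hN.trans ?_⟩
    rw [Metric.externalCoveringNumber, iInf_subtype]
  have hfin : N.Finite := Set.encard_ne_top_iff.1 (by rwa [hNcard])
  -- Cover centres may lie outside the model or too near the truth, so the test for the ball at `z`
  -- is centred at a point of `G` in that ball; this doubles the radius, whence 2ρ ≤ ar. If the ball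
  -- misses `G`, the zero test serves.
  have hlocal : ∀ z : Θ, ∃ φ : E.Obs n → ℝ≥0∞, Measurable φ ∧
      ∫⁻ x, φ x ∂(E.law n θ₀) ≤ e ∧
      ∀ θ ∈ G, dist θ z ≤ ρ → ∫⁻ x, (1 - φ x) ∂(E.law n θ) ≤ e := by
    intro z
    by_cases hz : ∃ θ₁ ∈ G, dist θ₁ z ≤ ρ
    · obtain ⟨θ₁, hθ₁, hz⟩ := hz
      obtain ⟨φ, hφm, -, hφ0, hφ⟩ := hT n hn r hr θ₁ (hGT hθ₁) (hGd θ₁ hθ₁)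
      refine ⟨φ, hφm, hφ0, fun θ hθ hθz => hφ θ (hGT hθ) ?_⟩
      calc dist θ θ₁ ≤ dist θ z + dist θ₁ z := dist_triangle_right θ θ₁ z
        _ ≤ a * r := by linarith
    · push Not at hz
      exact ⟨fun _ => 0, measurable_const, by simp, fun θ hθ h => absurd h (not_le.2 (hz θ hθ))⟩
  choose φ hφm hφ0 hφ using hlocal
  have hsm : Measurable fun x => ∑ z ∈ hfin.toFinset, φ z x :=
    Finset.measurable_fun_sum _ fun z _ => hφm z
  -- Truncation at one keeps a test: the union bound controls its first-kind error, and it still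
  -- dominates each local test up to one.
  refine ⟨fun x => min 1 (∑ z ∈ hfin.toFinset, φ z x), measurable_const.min hsm,
    fun x => min_le_left _ _, ?_, fun θ hθ => ?_⟩
  · have hcard : (hfin.toFinset.card : ℝ≥0∞) = covering (d n) ρ F := by
      rw [covering, ← hNcard, hfin.encard_eq_coe_toFinset_card]
      simp
    calc ∫⁻ x, min 1 (∑ z ∈ hfin.toFinset, φ z x) ∂(E.law n θ₀)
        ≤ ∫⁻ x, ∑ z ∈ hfin.toFinset, φ z x ∂(E.law n θ₀) := lintegral_mono fun x => min_le_right _ _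
      _ = ∑ z ∈ hfin.toFinset, ∫⁻ x, φ z x ∂(E.law n θ₀) :=
          lintegral_finsetSum _ fun z _ => hφm z
      _ ≤ ∑ z ∈ hfin.toFinset, e := Finset.sum_le_sum fun z _ => hφ0 z
      _ = covering (d n) ρ F * e := by rw [Finset.sum_const, nsmul_eq_mul, hcard]
      _ ≤ ENNReal.ofReal (Real.exp s) * e := by gcongr
      _ = _ := by rw [he, ofReal_exp_mul_ofReal_exp, sub_eq_add_neg]
  · obtain ⟨z, hz, hθz⟩ := hN (hGF hθ)
    have hθz' : dist θ z ≤ ρ := by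
      have h1 : edist θ z ≤ (ρ.toNNReal : ℝ≥0∞) := hθz
      rw [edist_dist] at h1
      have h2 := ENNReal.toReal_mono ENNReal.coe_ne_top h1
      rwa [ENNReal.toReal_ofReal dist_nonneg, ENNReal.coe_toReal, Real.coe_toNNReal _ hρ] at h2
    refine (lintegral_mono fun x => ?_).trans (hφ z θ hθ hθz')
    rcases le_total 1 (∑ z ∈ hfin.toFinset, φ z x) with h | h
    · simp [h]
    · simp only [min_eq_right h]
      exact tsub_le_tsub_left
        (Finset.single_le_sum (f := fun z => φ z x) (fun _ _ => zero_le) (hfin.mem_toFinset.2 hz)) 1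

/-- The integral of a function that is at most `1`, and at most `t` off a set `N`. -/
theorem lintegral_le_measure_add {X : Type*} [MeasurableSpace X] (Q : Measure X)
    [IsProbabilityMeasure Q] {f : X → ℝ≥0∞} (hf : ∀ θ, f θ ≤ 1) {N : Set X} {t : ℝ≥0∞}
    (hN : ∀ θ ∉ N, f θ ≤ t) : ∫⁻ θ, f θ ∂Q ≤ Q N + t := by
  -- `N` may be non-measurable; its measurable hull has the same mass.
  have hm := measurableSet_toMeasurable Q N
  calc ∫⁻ θ, f θ ∂Q ≤ ∫⁻ θ, ((toMeasurable Q N).indicator (fun _ => 1) θ + t) ∂Q := by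
        refine lintegral_mono fun θ => ?_
        by_cases h : θ ∈ toMeasurable Q N
        · simpa [h] using le_add_right (hf θ)
        · simpa [h] using hN θ fun h' => h (subset_toMeasurable Q N h')
    _ = Q N + t := by
        rw [lintegral_add_right _ measurable_const, lintegral_indicator hm]
        simp

theorem mem_model_of_isSmallest {S : Models Θ Λ} {θ₀ : Θ} {l₀ : Λ} (h : S.IsSmallest θ₀ l₀) :
    θ₀ ∈ S.model l₀ := by
  rw [h]
  exact Set.mem_iInter₂.2 fun l hl => hl

/-- A model that misses the truth cannot contain the model `l₀`, which does contain it. -/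
theorem mem_larger_or_mem_smaller {S : Models Θ Λ} {θ₀ : Θ} {l₀ l : Λ} (h : S.IsSmallest θ₀ l₀)
    (hl : l ≠ l₀) : l ∈ S.larger θ₀ l₀ ∨ l ∈ S.smaller l₀ := by
  by_cases hm : θ₀ ∈ S.model l
  · exact Or.inl ⟨hl, hm⟩
  · exact Or.inr fun hs => hm (hs (mem_model_of_isSmallest h))

/-- Hölder with exponents α and 1 - α. This trivial bound is used on parameter sets of small prior
mass. -/
theorem lintegral_test_mul_le_one (E : Experiments.{u, w} Θ) {n : ℕ} (φ : E.Obs n → ℝ≥0∞)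
    {θ₀ θ : Θ} {α : ℝ} (hα : 0 ≤ α) (hα1 : α ≤ 1) :
    ∫⁻ x, (1 - φ x) * ((E.dens n θ x : ℝ≥0∞) ^ α * (E.dens n θ₀ x : ℝ≥0∞) ^ (1 - α)) ∂(E.dom n) ≤
      1 := by
  calc _ ≤ ∫⁻ x, (E.dens n θ x : ℝ≥0∞) ^ α * (E.dens n θ₀ x : ℝ≥0∞) ^ (1 - α) ∂(E.dom n) :=
        lintegral_mono fun x => mul_le_of_le_one_left' tsub_le_self
    _ ≤ 1 := by
        refine (ENNReal.lintegral_mul_norm_pow_le (E.measurable_dens_left_coe n θ).aemeasurable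
          (E.measurable_dens_left_coe n θ₀).aemeasurable hα (by linarith) (by ring)).trans ?_
        simp [E.lintegral_dens]

theorem lintegral_test_mul_eq_law (E : Experiments.{u, w} Θ) {n : ℕ} {φ : E.Obs n → ℝ≥0∞}
    (hφ : Measurable φ) (θ₀ θ : Θ) :
    ∫⁻ x, (1 - φ x) * ((E.dens n θ x : ℝ≥0∞) ^ (1 : ℝ) *
      (E.dens n θ₀ x : ℝ≥0∞) ^ (1 - (1 : ℝ))) ∂(E.dom n) = ∫⁻ x, (1 - φ x) ∂(E.law n θ) := by
  have hm : Measurable fun x => 1 - φ x := measurable_const.sub hφ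
  rw [E.lintegral_law n θ hm]
  refine lintegral_congr fun x => ?_
  simp [mul_comm]

/-- Consistency of the regular posterior, under explicit conditions on the constants. -/
theorem consistent_regular [Countable Λ] {a b c K D C M H : ℝ} (hb : 0 < b) (hc : 0 < c)
    (hC : 0 < C) (hK0 : 0 < K) (hKa : 4 ≤ a * K) (hKb : 8 ≤ b * K ^ 2) (hD : c + 4 ≤ D)
    (hM0 : 0 < M) (hMa : 2 ≤ a * M) (hMC : C + 2 ≤ b * M ^ 2) (hMc : 8 * (c + 4) ≤ b * M ^ 2)
    (hMK : K ≤ M) (hH : c + 4 ≤ H)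
    (E : Experiments.{u, w} Θ) (S : Models Θ Λ) (d : ℕ → PseudoMetricSpace Θ) (θ₀ : Θ) (l₀ : Λ)
    (ε : ℕ → Λ → ℝ) (δ : ℕ → ℝ) (hS : S.IsSmallest θ₀ l₀) (hB1 : AssumptionB1 E S θ₀ l₀ c ε)
    (hB2 : AssumptionB2Regular S d θ₀ l₀ M H ε) (hB3 : AssumptionB3Regular S d θ₀ l₀ M ε δ)
    (hB4 : AssumptionB4 E S d θ₀ l₀ a b K D C ε δ) : Consistent E S θ₀ l₀ 1 := by
  classical
  obtain ⟨hsmall, hlarge, hsum⟩ := hB4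
  set B : ℝ≥0∞ := ∑' _l : S.smaller l₀, 1 with hB
  -- The summand over smaller models does not depend on the model, so summability already at n = 1
  -- makes them finite in number. Their set does not depend on n, hence neither does `B`.
  have hBt : B ≠ ∞ := by
    intro h
    have h1 := le_self_add.trans (hsum 1 le_rfl)
    have h2 : ∑' _l : S.smaller l₀, ENNReal.ofReal (Real.exp (-(C * (1 : ℕ) * δ 1 ^ 2))) =
        ENNReal.ofReal (Real.exp (-(C * (1 : ℕ) * δ 1 ^ 2))) * B := by
      rw [hB, ← ENNReal.tsum_mul_left]
      simp
    rw [h2, h, ENNReal.mul_top (by simpa using Real.exp_pos _)] at h1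
    simp at h1
  refine consistent_of_tests E S one_pos le_rfl hB1
    (fun n l => (S.smaller l₀).indicator (fun _ => 1) l +
      (S.larger θ₀ l₀).indicator (fun l => ENNReal.ofReal (Real.exp (-(C * n * ε n l ^ 2)))) l)
    (B := B + 1) (ENNReal.add_ne_top.2 ⟨hBt, by simp⟩) (fun n hn => ?_)
    (fun n hn hε0 l hl => ?_)
  · rw [ENNReal.tsum_add, ← tsum_subtype, ← tsum_subtype]
    gcongr
    exact le_add_self.trans (hsum n hn)
  have hn0 : (0 : ℝ) < n := by exact_mod_cast hn
  set R : ℝ := n * ε n l₀ ^ 2 with hR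
  have hR0 : 0 < R := by positivity
  -- It suffices to find a test that is good off a set of small prior probability.
  suffices hsuff : ∃ (φ : E.Obs n → ℝ≥0∞) (N : Set Θ), Measurable φ ∧ (∀ x, φ x ≤ 1) ∧
      ∫⁻ x, φ x ∂(E.law n θ₀) ≤ ENNReal.ofReal (Real.exp (-R)) *
        ((S.smaller l₀).indicator (fun _ => 1) l + (S.larger θ₀ l₀).indicator
          (fun l => ENNReal.ofReal (Real.exp (-(C * n * ε n l ^ 2)))) l) ∧
      (∀ θ ∉ N, ∫⁻ x, (1 - φ x) ∂(E.law n θ) ≤ ENNReal.ofReal (Real.exp (-((c + 4) * R)))) ∧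
      S.prior n l N ≤ 2 * ENNReal.ofReal (Real.exp (-((c + 4) * R))) by
    obtain ⟨φ, N, hφm, hφ1, hφ0, hφN, hN⟩ := hsuff
    refine ⟨φ, hφm, hφ1, hφ0, ?_⟩
    refine (lintegral_le_measure_add (S.prior n l) (N := N)
      (t := ENNReal.ofReal (Real.exp (-((c + 4) * R))))
      (fun θ => lintegral_test_mul_le_one E φ zero_le_one le_rfl) fun θ hθ => ?_).trans ?_
    · rw [lintegral_test_mul_eq_law E hφm]
      exact hφN θ hθ
    · calc _ ≤ 2 * ENNReal.ofReal (Real.exp (-((c + 4) * R))) +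
            ENNReal.ofReal (Real.exp (-((c + 4) * R))) := by gcongr
        _ = _ := by ring
  rcases mem_larger_or_mem_smaller hS hl with hl | hl
  · obtain ⟨htest, F, hF⟩ := hlarge l hl
    obtain ⟨hFT, hcov, hFQ⟩ := hF n hn
    obtain ⟨hle, hprior⟩ := hB2 l hl n hn
    set q : ℝ := n * ε n l ^ 2 with hq
    have hεl : 0 < ε n l := hε0.trans_le hle
    have hRq : R ≤ q := by
      rw [hR, hq]
      gcongr
    -- The first-kind exponent is q - bM²q ≤ -(C+1)q ≤ -R - Cq: the part Cq gives summability over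
    -- larger models and the rest gives the factor exp(-R).
    obtain ⟨φ, hφm, hφ1, hφ0, hφ⟩ := exists_test_of_covering E htest hn (ρ := ε n l)
      (r := M * ε n l) (s := q) hεl.le (by positivity) (by nlinarith)
      (G := F n \ {θ | (d n).dist θ θ₀ ≤ M * ε n l}) Set.sdiff_subset (Set.sdiff_subset.trans hFT)
      (fun θ hθ => not_le.1 hθ.2) hcov
    have hexp : b * n * (M * ε n l) ^ 2 = b * M ^ 2 * q := by
      rw [hq]
      ring
    rw [hexp] at hφ0 hφ
    refine ⟨φ, {θ | (d n).dist θ θ₀ ≤ M * ε n l} ∪ (F n)ᶜ, hφm, hφ1, ?_, fun θ hθ => ?_, ?_⟩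
    · rw [Set.indicator_of_mem hl]
      refine hφ0.trans ?_
      calc ENNReal.ofReal (Real.exp (q - b * M ^ 2 * q))
          ≤ ENNReal.ofReal (Real.exp (-R + -(C * n * ε n l ^ 2))) := by
            refine ofReal_exp_le ?_
            rw [mul_assoc C, ← hq]
            nlinarith
        _ ≤ _ := by
            rw [← ofReal_exp_mul_ofReal_exp]
            gcongr
            exact le_add_self
    · have h1 : θ ∈ F n \ {θ | (d n).dist θ θ₀ ≤ M * ε n l} := by
        refine ⟨by_contra fun h => hθ (Or.inr h), fun h => hθ (Or.inl h)⟩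
      refine (hφ θ h1).trans (ofReal_exp_le ?_)
      nlinarith
    · refine (measure_union_le _ _).trans ?_
      rw [two_mul]
      refine add_le_add (hprior.trans (ofReal_exp_le ?_)) (hFQ.trans (ofReal_exp_le ?_))
      · rw [mul_assoc H, ← hR]
        exact neg_le_neg (mul_le_mul_of_nonneg_right hH hR0.le)
      · rw [mul_assoc D, ← hq]
        exact neg_le_neg (mul_le_mul hD hRq hR0.le (by linarith))
  · obtain ⟨htest, F, hF⟩ := hsmall l hl
    obtain ⟨hFT, hcov, hFQ⟩ := hF n hn
    obtain ⟨hMδ, hinf⟩ := hB3 n hn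
    set q : ℝ := n * δ n ^ 2 with hq
    have hδ : 0 < δ n := lt_trans (by positivity) hMδ
    have hRq : M ^ 2 * R ≤ q := by
      have h1 : (M * ε n l₀) ^ 2 ≤ δ n ^ 2 := pow_le_pow_left₀ (by positivity) hMδ.le 2
      rw [hR, hq]
      nlinarith
    have hK : 2 * (δ n / K) ≤ a * (δ n / 2) := by
      rw [mul_div_assoc', div_le_iff₀ hK0]
      nlinarith
    have hdist : ∀ θ ∈ F n, δ n / 2 < (d n).dist θ θ₀ := fun θ hθ => by
      let := d n
      have h1 : Metric.infDist θ₀ (S.model l) ≤ dist θ₀ θ := Metric.infDist_le_dist_of_mem (hFT hθ)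
      have h2 := (hinf l hl).trans h1
      rw [dist_comm] at h2
      exact lt_of_lt_of_le (by linarith) h2
    -- Tests need a strict distance inequality, while identifiability gives only `≥ δ n`; hence the
    -- separation `δ n / 2` and the exponent b/4 · q.
    obtain ⟨φ, hφm, hφ1, hφ0, hφ⟩ := exists_test_of_covering E htest hn (ρ := δ n / K)
      (r := δ n / 2) (s := n * (δ n / K) ^ 2) (by positivity) (by positivity) hK
      (G := F n) subset_rfl hFT hdist hcov
    have hexp : b * n * (δ n / 2) ^ 2 = b / 4 * q := by
      rw [hq]
      ring
    have hexpK : n * (δ n / K) ^ 2 = q / K ^ 2 := by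
      rw [hq]
      ring
    -- The entropy uses up at most half of the exponent b/4 · q; the other half beats (c+4)R because
    -- M is large.
    have hqK : q / K ^ 2 ≤ b / 8 * q := by
      have hq0 : 0 < q := by positivity
      have h1 : 8 * q ≤ b * K ^ 2 * q := by gcongr
      rw [div_le_iff₀ (by positivity)]
      linarith
    have hbq : (c + 4) * R ≤ b / 8 * q := by
      have h1 : b / 8 * (M ^ 2 * R) ≤ b / 8 * q := by gcongr
      have h2 : 8 * (c + 4) * R ≤ b * M ^ 2 * R := by gcongr
      linarith
    have hbq0 : 0 < b * q := by positivity
    have hcR : 0 < (c + 3) * R := by positivity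
    -- K ≤ M makes the sieve rate `δ n / K` at least `ε n l₀`, so the sieve remainder is negligible
    -- on the scale R.
    have hKR : R ≤ q / K ^ 2 := by
      rw [le_div_iff₀ (by positivity)]
      calc R * K ^ 2 ≤ R * M ^ 2 := by gcongr
        _ ≤ q := by linarith
    rw [hexp] at hφ0 hφ
    refine ⟨φ, (F n)ᶜ, hφm, hφ1, ?_, fun θ hθ => ?_, ?_⟩
    · rw [Set.indicator_of_mem hl]
      refine hφ0.trans ?_
      calc ENNReal.ofReal (Real.exp (n * (δ n / K) ^ 2 - b / 4 * q))
          ≤ ENNReal.ofReal (Real.exp (-R)) := by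
            refine ofReal_exp_le ?_
            rw [hexpK]
            linarith
        _ ≤ _ := le_mul_of_one_le_right' le_self_add
    · refine (hφ θ (not_not.1 hθ)).trans (ofReal_exp_le ?_)
      linarith
    · refine (hFQ.trans (ofReal_exp_le ?_)).trans (le_mul_of_one_le_left' one_le_two)
      rw [mul_assoc D, hexpK]
      exact neg_le_neg (mul_le_mul hD hKR hR0.le (by linarith))

/-! ### Consistency of the fractional posterior -/

theorem lintegral_affinity_le_one (E : Experiments.{u, w} Θ) (n : ℕ) (θ θ' : Θ) {α : ℝ}
    (hα : 0 ≤ α) (hα1 : α ≤ 1) :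
    ∫⁻ x, (E.dens n θ x : ℝ≥0∞) ^ α * (E.dens n θ' x : ℝ≥0∞) ^ (1 - α) ∂(E.dom n) ≤ 1 := by
  simpa using lintegral_test_mul_le_one E (n := n) (fun _ => 0) (θ₀ := θ') (θ := θ) hα hα1

/-- A lower bound for the Rényi divergence is an upper bound for the affinity. -/
theorem lintegral_affinity_le_of_le_renyi (E : Experiments.{u, w} Θ) {n : ℕ} (hn : 1 ≤ n)
    {θ θ' : Θ} {α : ℝ} (hα : 0 ≤ α) (hα1 : α < 1) {t : ℝ}
    (h : (t : EReal) ≤ (((n : ℝ)⁻¹ : ℝ) : EReal) * renyi E α n θ θ') :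
    ∫⁻ x, (E.dens n θ x : ℝ≥0∞) ^ α * (E.dens n θ' x : ℝ≥0∞) ^ (1 - α) ∂(E.dom n) ≤
      ENNReal.ofReal (Real.exp (-((1 - α) * (n * t)))) := by
  have hI := lintegral_affinity_le_one E n θ θ' hα hα1.le
  rw [renyi] at h
  set I := ∫⁻ x, (E.dens n θ x : ℝ≥0∞) ^ α * (E.dens n θ' x : ℝ≥0∞) ^ (1 - α) ∂(E.dom n) with hIdef
  -- If the affinity vanishes the divergence is `⊤` and the bound is trivial.
  rcases eq_or_ne I 0 with h0 | h0
  · rw [h0]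
    exact zero_le
  have ht : I ≠ ∞ := ne_top_of_le_ne_top ENNReal.one_ne_top hI
  have hpos : 0 < I.toReal := ENNReal.toReal_pos h0 ht
  rw [ENNReal.log_pos_real h0 ht] at h
  have h' : t ≤ (n : ℝ)⁻¹ * (1 / (α - 1) * Real.log I.toReal) := by exact_mod_cast h
  have hn0 : (0 : ℝ) < n := by exact_mod_cast hn
  have hα0 : 0 < 1 - α := by linarith
  have hlog : Real.log I.toReal ≤ -((1 - α) * (n * t)) := by
    have h1 : (1 - α) * (n * t) ≤
        (1 - α) * (n * ((n : ℝ)⁻¹ * (1 / (α - 1) * Real.log I.toReal))) := by gcongr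
    have h2 : (1 - α) * (n * ((n : ℝ)⁻¹ * (1 / (α - 1) * Real.log I.toReal))) =
        -Real.log I.toReal := by
      have h3 : α - 1 ≠ 0 := by linarith
      field_simp
      ring
    linarith
  rw [← ENNReal.ofReal_toReal ht]
  exact ENNReal.ofReal_le_ofReal ((Real.log_le_iff_le_exp hpos).1 hlog)

/-- The affinities of orders `α` and `1 - α` control each other. -/
theorem lintegral_affinity_swap_le (E : Experiments.{u, w} Θ) (n : ℕ) (θ θ₀ : Θ) {α : ℝ}
    (hα : 0 < α) (hα1 : α < 1) :
    ∫⁻ x, (E.dens n θ x : ℝ≥0∞) ^ α * (E.dens n θ₀ x : ℝ≥0∞) ^ (1 - α) ∂(E.dom n) ≤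
      (∫⁻ x, (E.dens n θ₀ x : ℝ≥0∞) ^ α * (E.dens n θ x : ℝ≥0∞) ^ (1 - α) ∂(E.dom n)) ^
        min (α / (1 - α)) ((1 - α) / α) := by
  have hα0 : 0 < 1 - α := by linarith
  have hp := E.measurable_dens_left_coe n θ
  have hp₀ := E.measurable_dens_left_coe n θ₀
  have hf : Measurable fun x => (E.dens n θ₀ x : ℝ≥0∞) ^ α * (E.dens n θ x : ℝ≥0∞) ^ (1 - α) :=
    (hp₀.pow_const _).mul (hp.pow_const _)
  -- Hölder with exponents t and 1 - t. Matching powers of the two densities gives t = α/(1-α) with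
  -- `g` = p₀ if α ≤ 1/2, and t = (1-α)/α with `g` = p_θ otherwise.
  have key : ∀ t : ℝ, 0 ≤ t → t ≤ 1 → ∀ g : E.Obs n → ℝ≥0∞, Measurable g →
      ∫⁻ x, g x ∂(E.dom n) = 1 →
      (∀ x, (E.dens n θ x : ℝ≥0∞) ^ α * (E.dens n θ₀ x : ℝ≥0∞) ^ (1 - α) =
        ((E.dens n θ₀ x : ℝ≥0∞) ^ α * (E.dens n θ x : ℝ≥0∞) ^ (1 - α)) ^ t * g x ^ (1 - t)) →
      ∫⁻ x, (E.dens n θ x : ℝ≥0∞) ^ α * (E.dens n θ₀ x : ℝ≥0∞) ^ (1 - α) ∂(E.dom n) ≤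
        (∫⁻ x, (E.dens n θ₀ x : ℝ≥0∞) ^ α * (E.dens n θ x : ℝ≥0∞) ^ (1 - α) ∂(E.dom n)) ^ t := by
    intro t ht ht1 g hg hg1 heq
    simp_rw [heq]
    refine (ENNReal.lintegral_mul_norm_pow_le hf.aemeasurable hg.aemeasurable ht (by linarith)
      (by ring)).trans_eq ?_
    rw [hg1, ENNReal.one_rpow, mul_one]
  rcases le_total α (1 - α) with h | h
  · have hmin : min (α / (1 - α)) ((1 - α) / α) = α / (1 - α) :=
      min_eq_left (((div_le_one hα0).2 h).trans ((one_le_div hα).2 h))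
    have ht1 : α / (1 - α) ≤ 1 := (div_le_one hα0).2 h
    rw [hmin]
    refine key _ (by positivity) ht1 _ hp₀ (E.lintegral_dens n θ₀) fun x => ?_
    rw [ENNReal.mul_rpow_of_nonneg _ _ (by positivity), ← ENNReal.rpow_mul, ← ENNReal.rpow_mul,
      mul_right_comm, ← ENNReal.rpow_add_of_nonneg _ _ (by positivity) (by linarith), mul_comm]
    congr 2
    · field_simp
      ring
    · field_simp
  · have hmin : min (α / (1 - α)) ((1 - α) / α) = (1 - α) / α :=
      min_eq_right (((div_le_one hα).2 h).trans ((one_le_div hα0).2 h))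
    have ht1 : (1 - α) / α ≤ 1 := (div_le_one hα).2 h
    rw [hmin]
    refine key _ (by positivity) ht1 _ hp (E.lintegral_dens n θ) fun x => ?_
    rw [ENNReal.mul_rpow_of_nonneg _ _ (by positivity), ← ENNReal.rpow_mul, ← ENNReal.rpow_mul,
      mul_assoc, ← ENNReal.rpow_add_of_nonneg _ _ (by positivity) (by linarith), mul_comm]
    congr 2
    · field_simp
    · field_simp
      ring

/-- Consistency of the fractional posterior, under explicit conditions on the constants. -/
theorem consistent_fractional [Countable Λ] {α c M H : ℝ} (hα : 0 < α) (hα1 : α < 1)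
    (hM0 : 0 < M) (hM : c + 4 ≤ (1 - α) * M)
    (hM2 : c + 4 ≤ (1 - α) * min (α / (1 - α)) ((1 - α) / α) * M ^ 2) (hH : c + 4 ≤ H)
    (E : Experiments.{u, w} Θ) (S : Models Θ Λ) (θ₀ : Θ) (l₀ : Λ)
    (ε : ℕ → Λ → ℝ) (δ : ℕ → ℝ) (hS : S.IsSmallest θ₀ l₀) (hB1 : AssumptionB1 E S θ₀ l₀ c ε)
    (hB2 : AssumptionB2Fractional E S α θ₀ l₀ M H ε)
    (hB3 : AssumptionB3Fractional E S α θ₀ l₀ M ε δ) : Consistent E S θ₀ l₀ α := by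
  have hα0 : 0 < 1 - α := by linarith
  refine consistent_of_tests E S hα hα1.le hB1 (fun _ _ => 0) (B := 0) (by simp) (by simp)
    fun n hn hε0 l hl => ⟨fun _ => 0, measurable_const, by simp, by simp, ?_⟩
  have hn0 : (0 : ℝ) < n := by exact_mod_cast hn
  set R : ℝ := n * ε n l₀ ^ 2 with hR
  have hR0 : 0 < R := by positivity
  -- It suffices to bound the affinity off a set of small prior probability.
  suffices hsuff : ∃ N : Set Θ, S.prior n l N ≤ ENNReal.ofReal (Real.exp (-((c + 4) * R))) ∧
      ∀ θ ∉ N, ∫⁻ x, (E.dens n θ x : ℝ≥0∞) ^ α * (E.dens n θ₀ x : ℝ≥0∞) ^ (1 - α) ∂(E.dom n) ≤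
        ENNReal.ofReal (Real.exp (-((c + 4) * R))) by
    obtain ⟨N, hN, hθ⟩ := hsuff
    refine (lintegral_le_measure_add (S.prior n l) (N := N)
      (t := ENNReal.ofReal (Real.exp (-((c + 4) * R))))
      (fun θ => lintegral_test_mul_le_one E _ hα.le hα1.le) (by simpa using hθ)).trans ?_
    refine (add_le_add_left hN _).trans ?_
    rw [← two_mul]
    gcongr
    norm_num
  rcases mem_larger_or_mem_smaller hS hl with hl | hl
  · obtain ⟨hle, hprior⟩ := hB2 l hl n hn
    refine ⟨_, hprior.trans (ofReal_exp_le ?_), fun θ hθ =>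
      (lintegral_affinity_le_of_le_renyi E hn hα.le hα1 (not_le.1 hθ).le).trans
        (ofReal_exp_le ?_)⟩
    · rw [mul_assoc H, ← hR]
      exact neg_le_neg (mul_le_mul_of_nonneg_right hH hR0.le)
    · refine neg_le_neg ?_
      calc (c + 4) * R ≤ (1 - α) * M * R := by gcongr
        _ ≤ (1 - α) * M * (n * ε n l ^ 2) := by rw [hR]; gcongr
        _ = (1 - α) * (n * (M * ε n l ^ 2)) := by ring
  · obtain ⟨hMδ, hinf⟩ := hB3 n hn
    set t := min (α / (1 - α)) ((1 - α) / α) with ht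
    have ht0 : 0 < t := lt_min (by positivity) (by positivity)
    refine ⟨(S.model l)ᶜ, ?_, fun θ hθ => ?_⟩
    · have h1 : S.prior n l (S.model l)ᶜ = 0 := S.ae_mem_model n l
      rw [h1]
      exact zero_le
    · have h1 : ((δ n ^ 2 : ℝ) : EReal) ≤ (((n : ℝ)⁻¹ : ℝ) : EReal) * renyi E α n θ₀ θ :=
        (hinf l hl).trans (mul_le_mul_of_nonneg_left (iInf₂_le θ (not_not.1 hθ))
          (EReal.coe_nonneg.2 (by positivity)))
      -- Identifiability bounds the divergence from the truth to θ, the posterior produces the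
      -- affinity in the other order; the swap multiplies the exponent by `t`.
      refine (lintegral_affinity_swap_le E n θ θ₀ hα hα1).trans ?_
      refine (ENNReal.rpow_le_rpow (lintegral_affinity_le_of_le_renyi E hn hα.le hα1 h1)
        ht0.le).trans ?_
      rw [ENNReal.ofReal_rpow_of_pos (Real.exp_pos _), ← Real.exp_mul]
      refine ofReal_exp_le ?_
      have h2 : (M * ε n l₀) ^ 2 ≤ δ n ^ 2 := pow_le_pow_left₀ (by positivity) hMδ.le 2
      calc -((1 - α) * (n * δ n ^ 2)) * t = -((1 - α) * t * n * δ n ^ 2) := by ring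
        _ ≤ -((1 - α) * t * n * (M * ε n l₀) ^ 2) := by gcongr
        _ = -((1 - α) * t * M ^ 2 * R) := by rw [hR]; ring
        _ ≤ -((c + 4) * R) := by gcongr

end ModelSelection

/-! ### Choice of the constants -/

theorem mainTheorem1 :
    -- regular posterior
    (∀ a b c : ℝ, 0 < a → 0 < b → 0 < c →
      ∃ K₀ D₀ : ℝ, ∀ K D C : ℝ, K₀ ≤ K → D₀ ≤ D → 0 < C →
        ∃ M₀ H₀ : ℝ, ∀ M H : ℝ, M₀ ≤ M → H₀ ≤ H →
          ∀ (Θ : Type u) [MeasurableSpace Θ] (Λ : Type v) [Countable Λ]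
            (E : ModelSelection.Experiments.{u, w} Θ) (S : ModelSelection.Models Θ Λ)
            (d : ℕ → PseudoMetricSpace Θ) (θ₀ : Θ) (l₀ : Λ) (ε : ℕ → Λ → ℝ) (δ : ℕ → ℝ),
            S.IsSmallest θ₀ l₀ →
            ModelSelection.AssumptionB1 E S θ₀ l₀ c ε →
            ModelSelection.AssumptionB2Regular S d θ₀ l₀ M H ε →
            ModelSelection.AssumptionB3Regular S d θ₀ l₀ M ε δ →
            ModelSelection.AssumptionB4 E S d θ₀ l₀ a b K D C ε δ →
            ModelSelection.Consistent E S θ₀ l₀ 1) ∧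
    -- fractional posterior
    (∀ α c : ℝ, 0 < α → α < 1 → 0 < c →
      ∃ M₀ H₀ : ℝ, ∀ M H : ℝ, M₀ ≤ M → H₀ ≤ H →
        ∀ (Θ : Type u) [MeasurableSpace Θ] (Λ : Type v) [Countable Λ]
          (E : ModelSelection.Experiments.{u, w} Θ) (S : ModelSelection.Models Θ Λ)
          (θ₀ : Θ) (l₀ : Λ) (ε : ℕ → Λ → ℝ) (δ : ℕ → ℝ),
          S.IsSmallest θ₀ l₀ →
          ModelSelection.AssumptionB1 E S θ₀ l₀ c ε →
          ModelSelection.AssumptionB2Fractional E S α θ₀ l₀ M H ε →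
          ModelSelection.AssumptionB3Fractional E S α θ₀ l₀ M ε δ →
          ModelSelection.Consistent E S θ₀ l₀ α) := by
  -- Each threshold for K and M adds up the required lower bounds; the extra 1 gives K ≤ K² and M ≤
  -- M², so linear bounds also yield the quadratic ones.
  refine ⟨fun a b c ha hb hc => ⟨4 / a + 8 / b + 1, c + 4, fun K D C hK hD hC =>
    ⟨1 + 2 / a + (C + 2) / b + 8 * (c + 4) / b + K, c + 4, fun M H hM hH => ?_⟩⟩,
    fun α c hα hα1 hc => ?_⟩
  · intro Θ _ Λ _ E S d θ₀ l₀ ε δ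
    have h1 : 0 < 4 / a := by positivity
    have h2 : 0 < 8 / b := by positivity
    have h3 : 0 < 2 / a := by positivity
    have h4 : 0 < (C + 2) / b := by positivity
    have h5 : 0 < 8 * (c + 4) / b := by positivity
    have hKK : K ≤ K ^ 2 := le_self_pow₀ (by linarith) two_ne_zero
    have hMM : M ≤ M ^ 2 := le_self_pow₀ (by linarith) two_ne_zero
    exact ModelSelection.consistent_regular hb hc hC (by linarith)
      ((div_le_iff₀' ha).1 (by linarith)) ((div_le_iff₀' hb).1 (by linarith)) hD (by linarith)
      ((div_le_iff₀' ha).1 (by linarith)) ((div_le_iff₀' hb).1 (by linarith))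
      ((div_le_iff₀' hb).1 (by linarith)) (by linarith) hH E S d θ₀ l₀ ε δ
  · have hα0 : 0 < 1 - α := by linarith
    set t := min (α / (1 - α)) ((1 - α) / α) with ht
    have ht0 : 0 < t := lt_min (by positivity) (by positivity)
    refine ⟨1 + (c + 4) / (1 - α) + (c + 4) / ((1 - α) * t), c + 4, fun M H hM hH => ?_⟩
    intro Θ _ Λ _ E S θ₀ l₀ ε δ
    have h1 : 0 < (c + 4) / (1 - α) := by positivity
    have h2 : 0 < (c + 4) / ((1 - α) * t) := by positivity
    have hMM : M ≤ M ^ 2 := le_self_pow₀ (by linarith) two_ne_zero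
    exact ModelSelection.consistent_fractional hα hα1 (by linarith)
      ((div_le_iff₀' hα0).1 (by linarith)) ((div_le_iff₀' (by positivity)).1 (by linarith)) hH
      E S θ₀ l₀ ε δ
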